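/- **Theorem (Termination of FlexTender).** Consider $n\ge 3f+1$ nodes, at most $f$ of which are Byzantine; the others are correct. Senders are authenticated; Byzantine nodes may send anything to anybody at any time. There are unknown $GST$ and $\Delta>0$ such that every message sent or received by a correct node by time $t$ reaches every correct node before time $\max(t,GST)+\Delta$ (gossip-based, eventually synchronous communication). Local computation takes no time. Let every node be the proposer of infinitely many rounds, and let the three round timers $tmr_{P,r},tmr_{V,r},tmr_{C,r}$ last at least $2\Delta$ for all sufficiently large $r$. Correct nodes run the FlexTender protocol below for one block height, each from its own finite start time on. Then every correct node eventually commits some proposal (possibly the empty one), irrevocably; in particular, after $GST$ some proposal is eventually committed. **Notions.** A value is a finite list of transactions (or $nil$). Validity of values is such that the empty list is valid and sublists (subsequences, not necessarily contiguous) of valid values are valid. Each transaction $tx$ in a value $v$ has an endorsement policy, an upward closed family of sets of nodes. A quorum is $\lfloor (n+f)/2\rfloor+1$ distinct nodes ($2f+1$ if $n=3f+1$). Messages are PROPOSAL$(r,v,vr,rr)$ (accepted only from the proposer of round $r$), PREVOTE$(r,v,\texttt{CON},D)$ (the sender endorses the transactions of $v$ in $D$ and opposes the others; $D=nil$ means no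 opinion; if $\texttt{CON}$ is false the message carries endorsements only and is not counted as a vote) and PRECOMMIT$(r,v,X)$ (the sender suggests removing the transactions in $X$). A node's local view consists of the messages it has received. * $tx\in v$ is *properly endorsed in round $r$* if the nodes that endorsed it in PREVOTE messages for $v$ of round $r$ form a set in its policy; a node that sent two differing endorsements for $v$ in round $r$ counts as endorsing all of $v$. It is *vetoed* if the complement of the set of nodes opposing it is not in its policy. $v$ is properly endorsed in round $r$ if all its transactions are. * $v$ is *quorum-certified* (QC) in round $r$ if a quorum prevoted for it, and *examined* in round $r$ if a quorum precommitted it, whatever removals were suggested. $tx$ is *removable* from $v$ in round $r$ if at least $f+1$ nodes suggested removing it in PRECOMMIT messages for $v$ of round $r$. * $v$ is *certified* in round $r$ if, for some PROPOSAL$(r,v,*,rr)$, $v$ is valid, QC in round $r$, and properly endorsed in round $r$ or in round $rr$. **Protocol of a correct node $p$.** It keeps $round_p$, a phase (propose, prevote, precommit), and pairs $(lockedValue,lockedRound)$, $(validValue,validRound)$, $(refValue,refRound)$, initially $(nil,-1)$. It starts in round $0$. Entering a round resets the phase to propose and clears the timers of the previous round. The proposer then broadcasts PROPOSAL$(round_p,v,validRound_p,refRound_p)$,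 where $v$ is $validValue_p$ if that is not $nil$; otherwise $refValue_p$ without its first transaction that is removable in round $refRound_p$, if $refValue_p\ne nil$; otherwise any valid value. The other nodes start $tmr_P$. Until it commits, $p$ executes the following rules whenever they apply, in any order; a vote moves $p$ to the phase named after it, except that PREVOTE messages with $\texttt{CON}$ false do not change the phase. 1. *Propose phase*, on PROPOSAL$(round_p,v,-1,rr)$ such that either $rr=-1=refRound_p$, or some $v'$ was examined in round $rr$, $v$ is a sublist of $v'$, and every transaction in $v'$ but not in $v$ is removable from $v'$ in round $rr$: prevote $v$ with endorsements $D\subseteq v$ of $p$'s own choice if $v$ is valid and $lockedRound_p=-1$ or $lockedValue_p=v$; otherwise prevote $nil$. If $rr=-1\neq refRound_p$, prevote $nil$. 2. *Propose phase*, on PROPOSAL$(round_p,v,vr,rr)$ with $0\le vr<round_p$, $rr\ge 0$, $v$ QC in round $vr$ and properly endorsed in round $rr$: prevote $v$ (with $D=nil$) if $v$ is valid and $lockedRound_p\le vr$ or $lockedValue_p=v$; otherwise prevote $nil$. 3. *Propose phase*, $tmr_P$ expired: prevote $nil$. 4. *Prevote phase*, on a PROPOSAL$(round_p,v,-1,*)$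 with $v$ valid for which $p$ has not yet sent endorsements in this round: send them in a PREVOTE with $\texttt{CON}$ false. 5. *Prevote phase*: on a quorum of PREVOTE messages of this round for any values, start $tmr_V$ (once per round); on a quorum of PREVOTE messages for $nil$, precommit $nil$; if $v$ is certified in this round, set $(lockedValue_p,lockedRound_p)=(v,round_p)$ and precommit $v$ with $X=\emptyset$. 6. *Prevote phase, rapid removal*: if no value can be locked by rule 5, and a valid $v$ from a PROPOSAL$(round_p,v,-1,*)$ is QC in this round and each of its transactions is properly endorsed or vetoed in this round, precommit $v$, with $X$ the set of its transactions that are not properly endorsed in this round. 7. *Prevote phase*, $tmr_V$ expired and no value can be locked by rule 5: if some $v$ from a PROPOSAL$(round_p,v,-1,*)$ is QC in this round, precommit $v$ with $X$ as in rule 6; otherwise precommit $nil$. 8. *Propose or prevote phase*, on PROPOSAL messages of this round for two different values: precommit $nil$. 9. If $v$ is certified in some round $r>validRound_p$, set $(validValue_p,validRound_p)=(v,r)$ and set $refRound_p$ to $r$ if $v$ is properly endorsed in round $r$ and to the $rr$ of the proposal otherwise. 10. On a quorum of PRECOMMIT messages of this round for any values, start $tmr_C$ (once per round); when it expires, enter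 round $round_p+1$. 11. If, for some $r$ and some PROPOSAL$(r,v,-1,*)$, $v$ is examined in round $r$, some transaction of $v$ is removable in round $r$, $validRound_p=-1$, and $refValue_p=nil$ or $v$ is shorter than $refValue_p$: set $(refValue_p,refRound_p)=(v,r)$ and, if $round_p=r$, enter round $r+1$. 12. On messages of at least $f+1$ nodes of one round $r>round_p$: enter round $r$. 13. On a PROPOSAL$(r,v,*,*)$ for any round $r$ with $v$ valid and a quorum of PRECOMMIT messages of round $r$ for $v$ with $X=\emptyset$: commit $v$ and stop at this height. -/

import Mathlib

namespace FlexTender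

/-- The three phases of a round. -/
inductive Phase
  | propose
  | prevote
  | precommit

/-- Protocol messages of one block height. A value (block) is a list of transactions, `none` is
`nil` (for values) and `-1` (for rounds). Hashes are idealised: a vote carries the value itself.
* `proposal src r v vr rr`: PROPOSAL of `v` in round `r` with valid round `vr` and reference
  round `rr`;
* `prevote src r v con D`: PREVOTE with the flag CON. Here `D = some D'` says that the sender
  endorses the transactions of `v` that lie in `D'` and opposes the others, `D = none` that the
  message carries no opinion. If `con = false`, the message only carries endorsements;
* `precommit src r v X`: PRECOMMIT that suggests to remove the transactions in `X`. -/
inductive Msg (Node Tx : Type*)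
  | proposal (src : Node) (r : ℕ) (v : List Tx) (vr rr : Option ℕ)
  | prevote (src : Node) (r : ℕ) (v : Option (List Tx)) (con : Bool) (D : Option (Set Tx))
  | precommit (src : Node) (r : ℕ) (v : Option (List Tx)) (X : Set Tx)

/-- The (authenticated) sender of a message. -/
def Msg.src {Node Tx : Type*} : Msg Node Tx → Node
  | .proposal j _ _ _ _ => j
  | .prevote j _ _ _ _ => j
  | .precommit j _ _ _ => j

/-- The round of a message. -/
def Msg.round {Node Tx : Type*} : Msg Node Tx → ℕ
  | .proposal _ r _ _ _ => r
  | .prevote _ r _ _ _ => r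
  | .precommit _ r _ _ => r

/-- The data that an instance of the protocol at one block height is run with. -/
structure Params (Node Tx : Type*) where
  /-- the bound on the number of Byzantine nodes -/
  f : ℕ
  /-- the proposer of each round -/
  proposer : ℕ → Node
  /-- application-level validity of a block -/
  valid : List Tx → Prop
  /-- `policy v tx` is the endorsement policy of the execution results of `tx` in the block `v`:
  the monotone family of those sets of nodes whose endorsements suffice -/
  policy : List Tx → Tx → UpperSet (Set Node)
  timeoutPropose : ℕ → ℝ
  timeoutPrevote : ℕ → ℝ
  timeoutPrecommit : ℕ → ℝ
  /-- the time at which each node starts this block height -/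
  startTime : Node → ℝ

/-- The local state of a node. A timer holds its expiry time once it has been scheduled in the
current round. -/
structure NodeState (Node Tx : Type*) where
  /-- all messages received so far, and the node's own messages -/
  log : Set (Msg Node Tx)
  started : Prop
  round : ℕ
  phase : Phase
  lockedValue : Option (List Tx)
  lockedRound : Option ℕ
  validValue : Option (List Tx)
  validRound : Option ℕ
  refValue : Option (List Tx)
  refRound : Option ℕ
  timerPropose : Option ℝ
  timerPrevote : Option ℝ
  timerPrecommit : Option ℝ
  decision : Option (List Tx)

/-- The initial local state. -/
def NodeState.init (Node Tx : Type*) : NodeState Node Tx where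
  log := ∅
  started := False
  round := 0
  phase := .propose
  lockedValue := none
  lockedRound := none
  validValue := none
  validRound := none
  refValue := none
  refRound := none
  timerPropose := none
  timerPrevote := none
  timerPrecommit := none
  decision := none

/-- Adding a message to the log: used both for receiving a message and for broadcasting one (a
node gets its own messages at once; the others get them through gossip). -/
def NodeState.addMsg {Node Tx : Type*} (s : NodeState Node Tx) (m : Msg Node Tx) :
    NodeState Node Tx :=
  { s with log := insert m s.log }

/-- At least `k` different nodes have the property `Q`. -/
def AtLeast {Node : Type*} (k : ℕ) (Q : Node → Prop) : Prop :=
  ∃ S : Finset Node, k ≤ S.card ∧ ∀ j ∈ S, Q j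

section Predicates

variable {Node Tx : Type*} [Fintype Node] (P : Params Node Tx) (L : Set (Msg Node Tx))

/-- The size of a quorum, `⌊(n + f) / 2⌋ + 1` (that is, `2 f + 1` if `n = 3 f + 1`). -/
def quorum : ℕ := (Fintype.card Node + P.f) / 2 + 1

/-- The log `L` contains the PROPOSAL `(v, vr, rr)` of the proposer of round `r`. -/
def Proposed (r : ℕ) (v : List Tx) (vr rr : Option ℕ) : Prop :=
  Msg.proposal (P.proposer r) r v vr rr ∈ L

/-- A quorum of PREVOTE messages in round `r`, for any values or `nil`. -/
def AnyPrevotes (r : ℕ) : Prop :=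
  AtLeast (quorum P) fun j => ∃ v D, Msg.prevote j r v true D ∈ L

/-- A quorum of PREVOTE messages for `v` in round `r`. If `v = some u`, then `u` is
quorum-certified in round `r`. -/
def PrevotesFor (r : ℕ) (v : Option (List Tx)) : Prop :=
  AtLeast (quorum P) fun j => ∃ D, Msg.prevote j r v true D ∈ L

/-- A quorum of PRECOMMIT messages in round `r`, for any values or `nil`. -/
def AnyPrecommits (r : ℕ) : Prop :=
  AtLeast (quorum P) fun j => ∃ v X, Msg.precommit j r v X ∈ L

/-- A quorum of PRECOMMIT messages for `v` in round `r`, whatever removals they suggest. -/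
def PrecommitsFor (r : ℕ) (v : List Tx) : Prop :=
  AtLeast (quorum P) fun j => ∃ X, Msg.precommit j r (some v) X ∈ L

/-- A quorum of PRECOMMIT messages for `v` in round `r` that suggest no removal. -/
def CommitsFor (r : ℕ) (v : List Tx) : Prop :=
  AtLeast (quorum P) fun j => Msg.precommit j r (some v) ∅ ∈ L

/-- At least `f + 1` nodes suggested in round `r` to remove `tx` from `v`. -/
def Removable (r : ℕ) (v : List Tx) (tx : Tx) : Prop :=
  AtLeast (P.f + 1) fun j => ∃ X, Msg.precommit j r (some v) X ∈ L ∧ tx ∈ X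

/-- The nodes that count as endorsing `tx` within `v` in round `r`. A node that sent two differing
endorsements for `v` in round `r` counts as endorsing all transactions of `v`. -/
def endorsers (r : ℕ) (v : List Tx) (tx : Tx) : Set Node :=
  {j | (∃ con D, Msg.prevote j r (some v) con (some D) ∈ L ∧ tx ∈ D) ∨
    ∃ con D con' D', Msg.prevote j r (some v) con (some D) ∈ L ∧
      Msg.prevote j r (some v) con' (some D') ∈ L ∧ D ≠ D'}

/-- The nodes that oppose `tx` within `v` in round `r`. -/
def opposers (r : ℕ) (v : List Tx) (tx : Tx) : Set Node :=
  {j | ∃ con D, Msg.prevote j r (some v) con (some D) ∈ L ∧ tx ∉ D}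

/-- `tx` is properly endorsed within `v` by the PREVOTE messages of round `r`. -/
def TxEndorsed (r : ℕ) (v : List Tx) (tx : Tx) : Prop :=
  endorsers L r v tx ∈ P.policy v tx

/-- `tx` is vetoed within `v` in round `r`: the remaining nodes alone cannot satisfy its policy. -/
def Vetoed (r : ℕ) (v : List Tx) (tx : Tx) : Prop :=
  (opposers L r v tx)ᶜ ∉ P.policy v tx

/-- `v` is properly endorsed by the PREVOTE messages of round `r`. -/
def VerifyEndorsement (r : ℕ) (v : List Tx) : Prop :=
  ∀ tx ∈ v, TxEndorsed P L r v tx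

/-- `v` may be proposed with reference to round `r`: it arises from a value `v'` that was examined
in round `r` by removing transactions that at least `f + 1` nodes suggested to remove. -/
def VerifyReference (r : ℕ) (v : List Tx) : Prop :=
  ∃ v', PrecommitsFor P L r v' ∧ v.Sublist v' ∧ ∀ tx ∈ v', tx ∉ v → Removable P L r v' tx

/-- The transactions of `v` that are not properly endorsed in round `r`. -/
def excludedTx (r : ℕ) (v : List Tx) : Set Tx :=
  {tx | tx ∈ v ∧ ¬ TxEndorsed P L r v tx}

open Classical in
/-- `v` without its first removable transaction. -/
noncomputable def extract (r : ℕ) (v : List Tx) : List Tx :=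
  v.eraseP fun tx => decide (Removable P L r v tx)

end Predicates

section Handlers

variable {Node Tx : Type*} [Fintype Node] (P : Params Node Tx)

/-- The value that a proposer in state `s` proposes; `w` is used if a new value is needed. -/
noncomputable def proposalValue (s : NodeState Node Tx) (w : List Tx) : List Tx :=
  match s.validValue, s.refRound, s.refValue with
  | some v, _, _ => v
  | none, some r, some v => extract P s.log r v
  | none, _, _ => w

open Classical in
/-- Node `p` enters round `r` at time `t`. -/
noncomputable def startRound (p : Node) (t : ℝ) (r : ℕ) (w : List Tx)
    (s : NodeState Node Tx) : NodeState Node Tx :=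
  let s' := { s with
    round := r
    phase := .propose
    timerPropose := none
    timerPrevote := none
    timerPrecommit := none }
  if P.proposer r = p then
    s'.addMsg (.proposal p r (proposalValue P s w) s.validRound s.refRound)
  else
    { s' with timerPropose := some (t + P.timeoutPropose r) }

/-- Node `p` broadcasts a PREVOTE in its current round and enters the prevote phase. -/
def castPrevote (p : Node) (v : Option (List Tx)) (D : Option (Set Tx))
    (s : NodeState Node Tx) : NodeState Node Tx :=
  { s.addMsg (.prevote p s.round v true D) with phase := .prevote }

/-- Node `p` broadcasts a PRECOMMIT in its current round and enters the precommit phase. -/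
def castPrecommit (p : Node) (v : Option (List Tx)) (X : Set Tx)
    (s : NodeState Node Tx) : NodeState Node Tx :=
  { s.addMsg (.precommit p s.round v X) with phase := .precommit }

/-- In state `s` the proposed value `v` of round `r`, proposed with reference round `rr`, is
quorum-certified in round `r` and properly endorsed, by messages of round `rr` or `r`. -/
def Certified (s : NodeState Node Tx) (r : ℕ) (v : List Tx) (rr : Option ℕ) : Prop :=
  (∃ vr, Proposed P s.log r v vr rr) ∧ PrevotesFor P s.log r (some v) ∧ P.valid v ∧
    ((∃ r', rr = some r' ∧ VerifyEndorsement P s.log r' v) ∨ VerifyEndorsement P s.log r v)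

/-- In state `s` some value can be locked in the current round. -/
def Lockable (s : NodeState Node Tx) : Prop :=
  ∃ v rr, Certified P s s.round v rr

/-- `Handler P p t s s'`: in state `s`, at time `t`, some event handler of node `p` is enabled, and
its execution leads to the state `s'`. -/
inductive Handler (p : Node) (t : ℝ) : NodeState Node Tx → NodeState Node Tx → Prop
  /-- Prevote for a value without valid round, with endorsements `D`. -/
  | prevoteNew (s : NodeState Node Tx) (v : List Tx) (rr : Option ℕ) (D : Set Tx)
      (hphase : s.phase = .propose)
      (hprop : Proposed P s.log s.round v none rr)
      (href : (rr = none ∧ s.refRound = none) ∨ ∃ r', rr = some r' ∧ VerifyReference P s.log r' v)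
      (hvalid : P.valid v)
      (hlock : s.lockedRound = none ∨ s.lockedValue = some v)
      (hD : ∀ tx ∈ D, tx ∈ v) :
      Handler p t s (castPrevote p (some v) (some D) s)
  /-- Prevote `nil` since the value is invalid or the node is locked on another value. -/
  | rejectNew (s : NodeState Node Tx) (v : List Tx) (rr : Option ℕ)
      (hphase : s.phase = .propose)
      (hprop : Proposed P s.log s.round v none rr)
      (href : (rr = none ∧ s.refRound = none) ∨ ∃ r', rr = some r' ∧ VerifyReference P s.log r' v)
      (hbad : ¬ (P.valid v ∧ (s.lockedRound = none ∨ s.lockedValue = some v))) :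
      Handler p t s (castPrevote p none none s)
  /-- Prevote `nil` since the proposal references no round but the node knows one. (A failed
  check of a referenced round may still succeed later, so the node waits in that case.) -/
  | rejectUnreferenced (s : NodeState Node Tx) (v : List Tx)
      (hphase : s.phase = .propose)
      (hprop : Proposed P s.log s.round v none none)
      (href : s.refRound ≠ none) :
      Handler p t s (castPrevote p none none s)
  /-- Prevote for a value that was quorum-certified in an earlier round `vr`. -/
  | prevoteOld (s : NodeState Node Tx) (v : List Tx) (vr rr : ℕ)
      (hphase : s.phase = .propose)
      (hprop : Proposed P s.log s.round v (some vr) (some rr))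
      (hvr : vr < s.round)
      (hqc : PrevotesFor P s.log vr (some v))
      (hend : VerifyEndorsement P s.log rr v)
      (hvalid : P.valid v)
      (hlock : (∀ r, s.lockedRound = some r → r ≤ vr) ∨ s.lockedValue = some v) :
      Handler p t s (castPrevote p (some v) none s)
  /-- Prevote `nil` since that value is invalid or the node is locked on another value. -/
  | rejectOld (s : NodeState Node Tx) (v : List Tx) (vr rr : ℕ)
      (hphase : s.phase = .propose)
      (hprop : Proposed P s.log s.round v (some vr) (some rr))
      (hvr : vr < s.round)
      (hqc : PrevotesFor P s.log vr (some v))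
      (hend : VerifyEndorsement P s.log rr v)
      (hbad : ¬ (P.valid v ∧
        ((∀ r, s.lockedRound = some r → r ≤ vr) ∨ s.lockedValue = some v))) :
      Handler p t s (castPrevote p none none s)
  /-- Endorsements are sent even if the node has not voted for the proposed value. -/
  | endorseOnly (s : NodeState Node Tx) (v : List Tx) (rr : Option ℕ) (D : Set Tx)
      (hphase : s.phase = .prevote)
      (hprop : Proposed P s.log s.round v none rr)
      (hvalid : P.valid v)
      (hnew : ¬ ∃ con D', Msg.prevote p s.round (some v) con (some D') ∈ s.log)
      (hD : ∀ tx ∈ D, tx ∈ v) :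
      Handler p t s (s.addMsg (.prevote p s.round (some v) false (some D)))
  /-- Start the prevote timer. -/
  | schedulePrevote (s : NodeState Node Tx)
      (hphase : s.phase = .prevote)
      (hany : AnyPrevotes P s.log s.round)
      (hfirst : s.timerPrevote = none) :
      Handler p t s { s with timerPrevote := some (t + P.timeoutPrevote s.round) }
  /-- Lock a properly endorsed, quorum-certified value and precommit it. -/
  | lock (s : NodeState Node Tx) (v : List Tx) (rr : Option ℕ)
      (hphase : s.phase = .prevote)
      (hcert : Certified P s s.round v rr) :
      Handler p t s (castPrecommit p (some v) ∅
        { s with lockedValue := some v, lockedRound := some s.round })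
  /-- Record a more recent properly endorsed, quorum-certified value; its endorsements stem from
  round `r` if possible and from `rr` otherwise. -/
  | updateValid (s : NodeState Node Tx) (r : ℕ) (v : List Tx) (rr ref : Option ℕ)
      (hcert : Certified P s r v rr)
      (hrecent : ∀ r', s.validRound = some r' → r' < r)
      (href : (VerifyEndorsement P s.log r v ∧ ref = some r) ∨
        (¬ VerifyEndorsement P s.log r v ∧ ref = rr)) :
      Handler p t s { s with validValue := some v, validRound := some r, refRound := ref }
  /-- Precommit `nil` after a quorum of `nil` prevotes. -/
  | precommitNil (s : NodeState Node Tx)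
      (hphase : s.phase = .prevote)
      (hnil : PrevotesFor P s.log s.round none) :
      Handler p t s (castPrecommit p none ∅ s)
  /-- Precommit `nil` upon two different proposals in the current round. -/
  | conflict (s : NodeState Node Tx) (v v' : List Tx) (vr rr vr' rr' : Option ℕ)
      (hphase : s.phase ≠ .precommit)
      (hprop : Proposed P s.log s.round v vr rr)
      (hprop' : Proposed P s.log s.round v' vr' rr')
      (hne : v ≠ v') :
      Handler p t s (castPrecommit p none ∅ s)
  /-- Rapid removal: every transaction is properly endorsed or vetoed, and not all are properly
  endorsed. -/
  | rapidRemoval (s : NodeState Node Tx) (v : List Tx) (rr : Option ℕ)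
      (hphase : s.phase = .prevote)
      (hprop : Proposed P s.log s.round v none rr)
      (hqc : PrevotesFor P s.log s.round (some v))
      (hvalid : P.valid v)
      (hall : ∀ tx ∈ v, TxEndorsed P s.log s.round v tx ∨ Vetoed P s.log s.round v tx)
      (hlock : ¬ Lockable P s) :
      Handler p t s (castPrecommit p (some v) (excludedTx P s.log s.round v) s)
  /-- Start the precommit timer. -/
  | schedulePrecommit (s : NodeState Node Tx)
      (hany : AnyPrecommits P s.log s.round)
      (hfirst : s.timerPrecommit = none) :
      Handler p t s { s with timerPrecommit := some (t + P.timeoutPrecommit s.round) }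
  /-- Commit. -/
  | commit (s : NodeState Node Tx) (r : ℕ) (v : List Tx) (vr rr : Option ℕ)
      (hprop : Proposed P s.log r v vr rr)
      (hcommit : CommitsFor P s.log r v)
      (hvalid : P.valid v) :
      Handler p t s { s with decision := some v }
  /-- A shorter examined value from which some transaction can be removed becomes the reference;
  if it belongs to the current round, the next round begins. -/
  | updateRef (s s₁ s₂ : NodeState Node Tx) (r : ℕ) (v w : List Tx) (rr : Option ℕ)
      (hprop : Proposed P s.log r v none rr)
      (hex : PrecommitsFor P s.log r v)
      (hrem : ∃ tx ∈ v, Removable P s.log r v tx)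
      (hnovalid : s.validRound = none)
      (hshort : ∀ u, s.refValue = some u → v.length < u.length)
      (hw : P.valid w)
      (h₁ : s₁ = { s with refRound := some r, refValue := some v })
      (h₂ : (s.round = r ∧ s₂ = startRound P p t (r + 1) w s₁) ∨ (s.round ≠ r ∧ s₂ = s₁)) :
      Handler p t s s₂
  /-- Catch up with a later round. -/
  | skip (s : NodeState Node Tx) (r : ℕ) (w : List Tx)
      (hr : s.round < r)
      (hmsgs : AtLeast (P.f + 1) fun j => ∃ m ∈ s.log, m.src = j ∧ m.round = r)
      (hw : P.valid w) :
      Handler p t s (startRound P p t r w s)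
  /-- The propose timer expires. -/
  | timeoutPropose (s : NodeState Node Tx) (d : ℝ)
      (htimer : s.timerPropose = some d) (hd : d ≤ t)
      (hphase : s.phase = .propose) :
      Handler p t s (castPrevote p none none s)
  /-- The prevote timer expires, and a new proposal of this round is quorum-certified. (If the
  value can be locked, then the node locks it instead.) -/
  | timeoutPrevote (s : NodeState Node Tx) (d : ℝ) (v : List Tx) (rr : Option ℕ)
      (htimer : s.timerPrevote = some d) (hd : d ≤ t)
      (hphase : s.phase = .prevote)
      (hlock : ¬ Lockable P s)
      (hprop : Proposed P s.log s.round v none rr)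
      (hqc : PrevotesFor P s.log s.round (some v)) :
      Handler p t s (castPrecommit p (some v) (excludedTx P s.log s.round v) s)
  /-- The prevote timer expires, and no new proposal of this round is quorum-certified. -/
  | timeoutPrevoteNil (s : NodeState Node Tx) (d : ℝ)
      (htimer : s.timerPrevote = some d) (hd : d ≤ t)
      (hphase : s.phase = .prevote)
      (hlock : ¬ Lockable P s)
      (hno : ¬ ∃ v rr, Proposed P s.log s.round v none rr ∧
        PrevotesFor P s.log s.round (some v)) :
      Handler p t s (castPrecommit p none ∅ s)
  /-- The precommit timer expires. -/
  | timeoutPrecommit (s : NodeState Node Tx) (d : ℝ) (w : List Tx)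
      (htimer : s.timerPrecommit = some d) (hd : d ≤ t)
      (hw : P.valid w) :
      Handler p t s (startRound P p t (s.round + 1) w s)

/-- The actions of a correct node at one block height: it starts round `0` at its start time and
then executes handlers until it commits. -/
inductive Act (p : Node) (t : ℝ) (s s' : NodeState Node Tx) : Prop
  | start (w : List Tx) (hs : ¬ s.started) (ht : P.startTime p ≤ t) (hw : P.valid w)
      (h : s' = startRound P p t 0 w { s with started := True })
  | handle (hs : s.started) (hd : s.decision = none) (h : Handler P p t s s')

end Handlers

/-- The global configuration: the current time and the local states. (Only the states of correct
nodes matter.) -/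
structure Config (Node Tx : Type*) where
  now : ℝ
  node : Node → NodeState Node Tx

open Classical in
/-- The configuration after the state of node `p` became `s`. -/
noncomputable def Config.set {Node Tx : Type*} (c : Config Node Tx) (p : Node)
    (s : NodeState Node Tx) : Config Node Tx :=
  { c with node := Function.update c.node p s }

/-- One step of the system.
* A correct node receives a message. Senders are authenticated: a message of a correct node must
  have been sent by it. Byzantine nodes may send anything to anybody at any time.
* A correct node acts.
* Time passes. Local computation takes no time: time cannot pass while a correct node can act. -/
inductive Step {Node Tx : Type*} [Fintype Node] (P : Params Node Tx) (correct : Set Node)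
    (c : Config Node Tx) : Config Node Tx → Prop
  | receive (p : Node) (m : Msg Node Tx) (hp : p ∈ correct)
      (hauth : m.src ∈ correct → m ∈ (c.node m.src).log) :
      Step P correct c (c.set p ((c.node p).addMsg m))
  | act (p : Node) (s' : NodeState Node Tx) (hp : p ∈ correct)
      (hact : Act P p c.now (c.node p) s') :
      Step P correct c (c.set p s')
  | tick (t' : ℝ) (ht : c.now ≤ t')
      (hidle : ∀ t, c.now ≤ t → t < t' → ∀ p ∈ correct, ∀ s', ¬ Act P p t (c.node p) s') :
      Step P correct c { c with now := t' }

/-- Executions under eventual synchrony and gossip: a message that a correct node has sent or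
received by time `t` reaches every correct node before time `max t GST + Δ`. Time is unbounded. -/
structure IsExecution {Node Tx : Type*} [Fintype Node] (P : Params Node Tx) (correct : Set Node)
    (GST Δ : ℝ) (c : ℕ → Config Node Tx) : Prop where
  init : ∀ p ∈ correct, (c 0).node p = NodeState.init Node Tx
  step : ∀ k, Step P correct (c k) (c (k + 1))
  time : Filter.Tendsto (fun k => (c k).now) Filter.atTop Filter.atTop
  gossip : ∀ k, ∀ p ∈ correct, ∀ q ∈ correct, ∀ m ∈ ((c k).node p).log,
    ∃ j, m ∈ ((c j).node q).log ∧ (c j).now < max (c k).now GST + Δ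

end FlexTender

/-!
# Termination of FlexTender

As soon as one correct node decides, gossip makes every correct node decide
(`Setting.exists_decision`). So suppose that no correct node ever decides (`Undecided`).

*Cuts.* Time cannot pass while a correct node can act. Hence, in the last configuration before a
time `X` (a `Cut`), no handler of a correct node is enabled, neither then nor by the expiry of a
timer at some later time before `X`. After `GST`, each correct node has at that cut every message
that some correct node had by time `X - Δ`. All timing arguments compare two nodes in this way: a
node that could have acted on what another one acted on `Δ` earlier has done so.

*Rounds advance* (`Undecided.rounds_tendsto`). If no correct node gets beyond round `r`, then all
leave the propose phase of `r`: by the propose timer, or, for the proposer, since it can check its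
own proposal (`Sound.justified`). Then they leave the prevote phase by the prevote timer, or since
there are two proposals; now there is a quorum of precommits, and the precommit timer ends the
round.

*Synchrony* (`Synchronous`). References only get shorter, so they are constant from some time on.
From then on a round begins when the precommit timer of the first correct node expires. As timers
last at least `2 * Δ`, all correct nodes enter a round, leave its propose phase and leave its
prevote phase within `Δ` of one another (`le_round`, `phase_ne_propose`, `phase_eq_precommit`). In
particular, all locks of a round are taken more than `Δ` before the next round begins, whence
every correct proposer has a valid round at least as recent as every lock
(`exists_le_validRound`). So in a late round with a correct proposer all correct nodes vote for its
proposal (`GoodRound.exists_prevoted`).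

*Two cases.* If some correct node ever has a valid value, then eventually all do. A late correct
proposer proposes such a value, whose endorsements are already known; all correct nodes lock and
precommit it, and it is decided (`GoodRound.validRound_eq_none`). Otherwise no value is ever
certified. The proposal of a late correct proposer is quorum-certified and valid, so some
transaction `tx` in it is never properly endorsed. Hence every correct node suggests to remove
`tx`, and the proposal becomes a reference that is shorter than the one its proposer had
(`GoodRound.exists_certified`), although references no longer change.
-/

namespace FlexTender

/-! ### Counting nodes -/

section Counting

variable {Node : Type*}

theorem AtLeast.imp {k : ℕ} {Q Q' : Node → Prop} (h : AtLeast k Q) (hQ : ∀ j, Q j → Q' j) :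
    AtLeast k Q' := by
  obtain ⟨S, hS, hSQ⟩ := h
  exact ⟨S, hS, fun j hj => hQ j (hSQ j hj)⟩

theorem AtLeast.of_le {k l : ℕ} {Q : Node → Prop} (h : AtLeast k Q) (hl : l ≤ k) :
    AtLeast l Q := by
  obtain ⟨S, hS, hSQ⟩ := h
  exact ⟨S, hl.trans hS, hSQ⟩

theorem AtLeast.exists_mem [Finite Node] {A : Set Node} {k : ℕ} {Q : Node → Prop}
    (h : AtLeast k Q) (hA : Aᶜ.ncard < k) : ∃ j ∈ A, Q j := by
  obtain ⟨S, hS, hSQ⟩ := h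
  by_contra! hno
  have hsub : (S : Set Node) ⊆ Aᶜ := fun j hj hjA => hno j hjA (hSQ j hj)
  have := Set.ncard_le_ncard hsub (Set.toFinite _)
  rw [Set.ncard_coe_finset] at this
  omega

theorem AtLeast.of_forall_mem [Finite Node] {A : Set Node} {k : ℕ} {Q : Node → Prop}
    (hA : k + Aᶜ.ncard ≤ Nat.card Node) (hQ : ∀ j ∈ A, Q j) : AtLeast k Q := by
  classical
  have hfin : A.Finite := Set.toFinite A
  refine ⟨hfin.toFinset, ?_, fun j hj => hQ j (by simpa using hj)⟩
  have h1 := Set.ncard_add_ncard_compl A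
  rw [Set.ncard_eq_toFinset_card A hfin] at h1
  omega

end Counting

/-! ### Predicates that persist as a log grows -/

section Monotone

variable {Node Tx : Type*} {P : Params Node Tx} {L L' : Set (Msg Node Tx)}

theorem Removable.mono (hL : L ⊆ L') {r : ℕ} {v : List Tx} {tx : Tx}
    (h : Removable P L r v tx) : Removable P L' r v tx :=
  AtLeast.imp h fun _ ⟨X, hm, hX⟩ => ⟨X, hL hm, hX⟩

theorem endorsers_mono (hL : L ⊆ L') (r : ℕ) (v : List Tx) (tx : Tx) :
    endorsers L r v tx ⊆ endorsers L' r v tx := by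
  rintro j (⟨con, D, hm, hD⟩ | ⟨con, D, con', D', hm, hm', hne⟩)
  · exact Or.inl ⟨con, D, hL hm, hD⟩
  · exact Or.inr ⟨con, D, con', D', hL hm, hL hm', hne⟩

theorem TxEndorsed.mono (hL : L ⊆ L') {r : ℕ} {v : List Tx} {tx : Tx}
    (h : TxEndorsed P L r v tx) : TxEndorsed P L' r v tx :=
  (P.policy v tx).upper (endorsers_mono hL r v tx) h

theorem Vetoed.mono (hL : L ⊆ L') {r : ℕ} {v : List Tx} {tx : Tx}
    (h : Vetoed P L r v tx) : Vetoed P L' r v tx := by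
  refine fun hmem => h ((P.policy v tx).upper ?_ hmem)
  refine Set.compl_subset_compl.2 ?_
  rintro j ⟨con, D, hm, hD⟩
  exact ⟨con, D, hL hm, hD⟩

theorem VerifyEndorsement.mono (hL : L ⊆ L') {r : ℕ} {v : List Tx}
    (h : VerifyEndorsement P L r v) : VerifyEndorsement P L' r v :=
  fun tx htx => (h tx htx).mono hL

theorem extract_sublist (r : ℕ) (v : List Tx) : (extract P L r v).Sublist v :=
  List.eraseP_sublist

open Classical in
theorem length_extract_lt {r : ℕ} {v : List Tx} (h : ∃ tx ∈ v, Removable P L r v tx) :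
    (extract P L r v).length < v.length := by
  obtain ⟨tx, htx, hrem⟩ := h
  have := List.length_eraseP_of_mem (p := fun tx => decide (Removable P L r v tx)) htx (by simpa)
  have hpos : 0 < v.length := List.length_pos_of_mem htx
  unfold extract
  rw [this]
  omega

theorem removable_of_notMem_extract {r : ℕ} {v : List Tx} {tx : Tx} (h : tx ∈ v)
    (h' : tx ∉ extract P L r v) : Removable P L r v tx := by
  by_contra hno
  exact h' ((List.mem_eraseP_of_neg (by simpa using hno)).2 h)

variable [Fintype Node]

theorem AnyPrevotes.mono (hL : L ⊆ L') {r : ℕ} (h : AnyPrevotes P L r) : AnyPrevotes P L' r :=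
  AtLeast.imp h fun _ ⟨v, D, hm⟩ => ⟨v, D, hL hm⟩

theorem PrevotesFor.mono (hL : L ⊆ L') {r : ℕ} {v : Option (List Tx)}
    (h : PrevotesFor P L r v) : PrevotesFor P L' r v :=
  AtLeast.imp h fun _ ⟨D, hm⟩ => ⟨D, hL hm⟩

theorem AnyPrecommits.mono (hL : L ⊆ L') {r : ℕ} (h : AnyPrecommits P L r) :
    AnyPrecommits P L' r :=
  AtLeast.imp h fun _ ⟨v, X, hm⟩ => ⟨v, X, hL hm⟩

theorem PrecommitsFor.mono (hL : L ⊆ L') {r : ℕ} {v : List Tx}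
    (h : PrecommitsFor P L r v) : PrecommitsFor P L' r v :=
  AtLeast.imp h fun _ ⟨X, hm⟩ => ⟨X, hL hm⟩

theorem PrecommitsFor.any {r : ℕ} {v : List Tx} (h : PrecommitsFor P L r v) :
    AnyPrecommits P L r :=
  AtLeast.imp h fun _ ⟨X, hm⟩ => ⟨some v, X, hm⟩

theorem CommitsFor.mono (hL : L ⊆ L') {r : ℕ} {v : List Tx}
    (h : CommitsFor P L r v) : CommitsFor P L' r v :=
  AtLeast.imp h fun _ hm => hL hm

theorem VerifyReference.mono (hL : L ⊆ L') {r : ℕ} {v : List Tx}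
    (h : VerifyReference P L r v) : VerifyReference P L' r v := by
  obtain ⟨v', hv', hsub, hrem⟩ := h
  exact ⟨v', hv'.mono hL, hsub, fun tx h1 h2 => (hrem tx h1 h2).mono hL⟩

theorem Certified.mono {s s' : NodeState Node Tx} (hL : s.log ⊆ s'.log) {r : ℕ} {v : List Tx}
    {rr : Option ℕ} (h : Certified P s r v rr) : Certified P s' r v rr := by
  obtain ⟨⟨vr, hp⟩, hq, hv, he⟩ := h
  refine ⟨⟨vr, hL hp⟩, hq.mono hL, hv, ?_⟩
  rcases he with ⟨r', hr', he⟩ | he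
  · exact Or.inl ⟨r', hr', he.mono hL⟩
  · exact Or.inr (he.mono hL)

/-- The information in the log `L` by which a proposal `(v, vr, rr)` can be checked: a referenced
round, or the quorum certificate and the endorsements of an older value. -/
def Justified (P : Params Node Tx) (L : Set (Msg Node Tx)) (v : List Tx) (vr rr : Option ℕ) :
    Prop :=
  (vr = none ∧ (rr = none ∨ ∃ r', rr = some r' ∧ VerifyReference P L r' v)) ∨
    ∃ x y, vr = some x ∧ rr = some y ∧ PrevotesFor P L x (some v) ∧ VerifyEndorsement P L y v

theorem Justified.mono (hL : L ⊆ L') {v : List Tx} {vr rr : Option ℕ}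
    (h : Justified P L v vr rr) : Justified P L' v vr rr := by
  rcases h with ⟨h1, h2⟩ | ⟨x, y, h1, h2, h3, h4⟩
  · refine Or.inl ⟨h1, h2.imp_right ?_⟩
    rintro ⟨r', h3, h4⟩
    exact ⟨r', h3, h4.mono hL⟩
  · exact Or.inr ⟨x, y, h1, h2, h3.mono hL, h4.mono hL⟩

end Monotone

/-! ### Enabled handlers -/

section Enabled

variable {Node Tx : Type*} [Fintype Node] {P : Params Node Tx} {s : NodeState Node Tx}

/-- A node in the propose phase never waits once it can check the proposal. -/
theorem exists_handler_of_justified (p : Node) (t : ℝ) (hphase : s.phase = .propose)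
    {v : List Tx} {vr rr : Option ℕ} (hprop : Proposed P s.log s.round v vr rr)
    (hjust : Justified P s.log v vr rr) (hvr : ∀ x, vr = some x → x < s.round) :
    ∃ s', Handler P p t s s' := by
  rcases hjust with ⟨rfl, hrr⟩ | ⟨x, y, rfl, rfl, hqc, hend⟩
  · by_cases href : (rr = none ∧ s.refRound = none) ∨
        ∃ r', rr = some r' ∧ VerifyReference P s.log r' v
    · by_cases hgood : P.valid v ∧ (s.lockedRound = none ∨ s.lockedValue = some v)
      · exact ⟨_, .prevoteNew s v rr ∅ hphase hprop href hgood.1 hgood.2 (by simp)⟩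
      · exact ⟨_, .rejectNew s v rr hphase hprop href hgood⟩
    · rcases hrr with rfl | hrr
      · exact ⟨_, .rejectUnreferenced s v hphase hprop (by tauto)⟩
      · exact absurd (Or.inr hrr) href
  · by_cases hgood : P.valid v ∧
        ((∀ r, s.lockedRound = some r → r ≤ x) ∨ s.lockedValue = some v)
    · exact ⟨_, .prevoteOld s v x y hphase hprop (hvr x rfl) hqc hend hgood.1 hgood.2⟩
    · exact ⟨_, .rejectOld s v x y hphase hprop (hvr x rfl) hqc hend hgood⟩

/-- A node in the prevote phase never waits once its prevote timer has expired. -/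
theorem exists_handler_of_timerPrevote (p : Node) {t d : ℝ} (hphase : s.phase = .prevote)
    (htimer : s.timerPrevote = some d) (hd : d ≤ t) : ∃ s', Handler P p t s s' := by
  by_cases hlock : Lockable P s
  · obtain ⟨v, rr, hcert⟩ := hlock
    exact ⟨_, .lock s v rr hphase hcert⟩
  · by_cases hno : ∃ v rr, Proposed P s.log s.round v none rr ∧
        PrevotesFor P s.log s.round (some v)
    · obtain ⟨v, rr, hprop, hqc⟩ := hno
      exact ⟨_, .timeoutPrevote s d v rr htimer hd hphase hlock hprop hqc⟩
    · exact ⟨_, .timeoutPrevoteNil s d htimer hd hphase hlock hno⟩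

theorem exists_handler_of_rapidRemoval (p : Node) (t : ℝ) (hphase : s.phase = .prevote)
    {v : List Tx} {rr : Option ℕ} (hprop : Proposed P s.log s.round v none rr)
    (hqc : PrevotesFor P s.log s.round (some v)) (hvalid : P.valid v)
    (hall : ∀ tx ∈ v, TxEndorsed P s.log s.round v tx ∨ Vetoed P s.log s.round v tx) :
    ∃ s', Handler P p t s s' := by
  by_cases hlock : Lockable P s
  · obtain ⟨v, rr, hcert⟩ := hlock
    exact ⟨_, .lock s v rr hphase hcert⟩
  · exact ⟨_, .rapidRemoval s v rr hphase hprop hqc hvalid hall hlock⟩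

theorem exists_handler_of_certified (p : Node) (t : ℝ) {r : ℕ} {v : List Tx} {rr : Option ℕ}
    (hcert : Certified P s r v rr) (hrecent : ∀ r', s.validRound = some r' → r' < r) :
    ∃ s', Handler P p t s s' := by
  by_cases he : VerifyEndorsement P s.log r v
  · exact ⟨_, .updateValid s r v rr _ hcert hrecent (Or.inl ⟨he, rfl⟩)⟩
  · exact ⟨_, .updateValid s r v rr _ hcert hrecent (Or.inr ⟨he, rfl⟩)⟩

theorem exists_handler_of_removable (p : Node) (t : ℝ) {r : ℕ} {v : List Tx} {rr : Option ℕ}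
    (hvalid_nil : P.valid []) (hprop : Proposed P s.log r v none rr)
    (hex : PrecommitsFor P s.log r v) (hrem : ∃ tx ∈ v, Removable P s.log r v tx)
    (hnovalid : s.validRound = none)
    (hshort : ∀ u, s.refValue = some u → v.length < u.length) :
    ∃ s', Handler P p t s s' := by
  by_cases hr : s.round = r
  · exact ⟨_, .updateRef s _ _ r v [] rr hprop hex hrem hnovalid hshort hvalid_nil rfl
      (Or.inl ⟨hr, rfl⟩)⟩
  · exact ⟨_, .updateRef s _ _ r v [] rr hprop hex hrem hnovalid hshort hvalid_nil rfl
      (Or.inr ⟨hr, rfl⟩)⟩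

end Enabled

/-! ### Single actions of a node -/

section Actions

variable {Node Tx : Type*} {P : Params Node Tx} {p : Node} {t : ℝ} {s s' : NodeState Node Tx}

section StartRound

variable (P p t) (r : ℕ) (w : List Tx) (s)

@[simp] theorem startRound_started : (startRound P p t r w s).started = s.started := by
  unfold startRound; dsimp only; split <;> rfl

@[simp] theorem startRound_round : (startRound P p t r w s).round = r := by
  unfold startRound; dsimp only; split <;> rfl

@[simp] theorem startRound_phase : (startRound P p t r w s).phase = .propose := by
  unfold startRound; dsimp only; split <;> rfl

@[simp] theorem startRound_lockedRound :
    (startRound P p t r w s).lockedRound = s.lockedRound := by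
  unfold startRound; dsimp only; split <;> rfl

@[simp] theorem startRound_validValue :
    (startRound P p t r w s).validValue = s.validValue := by
  unfold startRound; dsimp only; split <;> rfl

@[simp] theorem startRound_validRound :
    (startRound P p t r w s).validRound = s.validRound := by
  unfold startRound; dsimp only; split <;> rfl

@[simp] theorem startRound_refValue : (startRound P p t r w s).refValue = s.refValue := by
  unfold startRound; dsimp only; split <;> rfl

@[simp] theorem startRound_refRound : (startRound P p t r w s).refRound = s.refRound := by
  unfold startRound; dsimp only; split <;> rfl

@[simp] theorem startRound_timerPrevote : (startRound P p t r w s).timerPrevote = none := by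
  unfold startRound; dsimp only; split <;> rfl

@[simp] theorem startRound_timerPrecommit :
    (startRound P p t r w s).timerPrecommit = none := by
  unfold startRound; dsimp only; split <;> rfl

@[simp] theorem startRound_decision : (startRound P p t r w s).decision = s.decision := by
  unfold startRound; dsimp only; split <;> rfl

theorem startRound_log_of_eq (h : P.proposer r = p) : (startRound P p t r w s).log =
    insert (.proposal p r (proposalValue P s w) s.validRound s.refRound) s.log := by
  unfold startRound; dsimp only; rw [if_pos h]; rfl

theorem startRound_log_of_ne (h : P.proposer r ≠ p) :
    (startRound P p t r w s).log = s.log := by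
  unfold startRound; dsimp only; rw [if_neg h]

theorem startRound_timerPropose_of_ne (h : P.proposer r ≠ p) :
    (startRound P p t r w s).timerPropose = some (t + P.timeoutPropose r) := by
  unfold startRound; dsimp only; rw [if_neg h]

theorem startRound_timerPropose_of_eq (h : P.proposer r = p) :
    (startRound P p t r w s).timerPropose = none := by
  unfold startRound; dsimp only; rw [if_pos h]; rfl

theorem log_subset_startRound : s.log ⊆ (startRound P p t r w s).log := by
  by_cases h : P.proposer r = p
  · rw [startRound_log_of_eq P p t s r w h]; exact Set.subset_insert _ _
  · rw [startRound_log_of_ne P p t s r w h]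

theorem startRound_log_cases : (startRound P p t r w s).log = s.log ∨
    ∃ m : Msg Node Tx, m.src = p ∧ m.round = r ∧ (startRound P p t r w s).log = insert m s.log := by
  by_cases h : P.proposer r = p
  · exact Or.inr ⟨_, rfl, rfl, startRound_log_of_eq P p t s r w h⟩
  · exact Or.inl (startRound_log_of_ne P p t s r w h)

end StartRound

/-- Within a round, phases only move forward and scheduled timers stay. -/
structure SameRound (s s' : NodeState Node Tx) : Prop where
  round : s'.round = s.round
  propose : s'.phase = .propose → s.phase = .propose
  precommit : s.phase = .precommit → s'.phase = .precommit
  timerPropose : s'.timerPropose = s.timerPropose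
  timerPrevote : ∀ d, s.timerPrevote = some d → s'.timerPrevote = some d
  timerPrecommit : ∀ d, s.timerPrecommit = some d → s'.timerPrecommit = some d

theorem SameRound.refl (s : NodeState Node Tx) : SameRound s s :=
  ⟨rfl, id, id, rfl, fun _ => id, fun _ => id⟩

theorem SameRound.trans {s'' : NodeState Node Tx} (h : SameRound s s') (h' : SameRound s' s'') :
    SameRound s s'' where
  round := h'.round.trans h.round
  propose := h.propose ∘ h'.propose
  precommit := h'.precommit ∘ h.precommit
  timerPropose := h'.timerPropose.trans h.timerPropose
  timerPrevote d := h'.timerPrevote d ∘ h.timerPrevote d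
  timerPrecommit d := h'.timerPrecommit d ∘ h.timerPrecommit d

variable [Fintype Node]

/-- The ways in which a node comes to a later round: its precommit timer expires, it finds a new
reference in its current round, or it catches up. -/
inductive Advance (P : Params Node Tx) (p : Node) (t : ℝ) (s s' : NodeState Node Tx) : Prop
  | timeout (d : ℝ) (w : List Tx) (htimer : s.timerPrecommit = some d) (hd : d ≤ t)
      (hw : P.valid w) (h : s' = startRound P p t (s.round + 1) w s)
  | reference (v w : List Tx) (rr : Option ℕ)
      (hprop : Proposed P s.log s.round v none rr)
      (hex : PrecommitsFor P s.log s.round v)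
      (hrem : ∃ tx ∈ v, Removable P s.log s.round v tx)
      (hnovalid : s.validRound = none)
      (hshort : ∀ u, s.refValue = some u → v.length < u.length)
      (hw : P.valid w)
      (h : s' = startRound P p t (s.round + 1) w
        { s with refRound := some s.round, refValue := some v })
  | skip (r : ℕ) (w : List Tx) (hr : s.round < r)
      (hmsgs : AtLeast (P.f + 1) fun j => ∃ m ∈ s.log, m.src = j ∧ m.round = r)
      (hw : P.valid w) (h : s' = startRound P p t r w s)

theorem Handler.advance_or_round_eq (h : Handler P p t s s') :
    Advance P p t s s' ∨ s'.round = s.round := by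
  cases h with
  | updateRef s₁ _ r v w rr hprop hex hrem hnovalid hshort hw h₁ h₂ =>
    subst h₁
    rcases h₂ with ⟨rfl, h₂⟩ | ⟨h₂, rfl⟩
    · exact Or.inl (.reference v w rr hprop hex hrem hnovalid hshort hw h₂)
    · exact Or.inr rfl
  | skip r w hr hmsgs hw => exact Or.inl (.skip r w hr hmsgs hw rfl)
  | timeoutPrecommit d w htimer hd hw => exact Or.inl (.timeout d w htimer hd hw rfl)
  | _ => exact Or.inr rfl

theorem Advance.round_lt (h : Advance P p t s s') : s.round < s'.round := by
  cases h with
  | timeout d w htimer hd hw h => simp [h]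
  | reference v w rr hprop hex hrem hnovalid hshort hw h => simp [h]
  | skip r w hr hmsgs hw h => simpa [h] using hr

/-- A later round starts afresh; only the reference may have been replaced at that moment. -/
theorem Advance.exists_eq_startRound (h : Advance P p t s s') :
    ∃ s₁ w, s' = startRound P p t s'.round w s₁ := by
  cases h with
  | timeout d w htimer hd hw h => exact ⟨s, w, by simp [h]⟩
  | reference v w rr hprop hex hrem hnovalid hshort hw h =>
    exact ⟨{ s with refRound := some s.round, refValue := some v }, w, by rw [h, startRound_round]⟩
  | skip r w hr hmsgs hw h => exact ⟨s, w, by simp [h]⟩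

theorem Handler.started_eq (h : Handler P p t s s') : s'.started = s.started := by
  cases h with
  | updateRef s₁ _ r v w rr hprop hex hrem hnovalid hshort hw h₁ h₂ =>
    subst h₁
    rcases h₂ with ⟨rfl, rfl⟩ | ⟨h₂, rfl⟩ <;> simp
  | skip | timeoutPrecommit => simp
  | _ => rfl

theorem Handler.log_cases (h : Handler P p t s s') : s'.log = s.log ∨
    ∃ m : Msg Node Tx, m.src = p ∧ m.round = s'.round ∧ s'.log = insert m s.log := by
  cases h with
  | updateRef s₁ _ r v w rr hprop hex hrem hnovalid hshort hw h₁ h₂ =>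
    subst h₁
    rcases h₂ with ⟨rfl, rfl⟩ | ⟨h₂, rfl⟩
    · simpa using startRound_log_cases P p t _ (s.round + 1) w
    · exact Or.inl rfl
  | skip r w hr hmsgs hw => simpa using startRound_log_cases P p t s r w
  | timeoutPrecommit d w htimer hd hw =>
    simpa using startRound_log_cases P p t s (s.round + 1) w
  | schedulePrevote | updateValid | schedulePrecommit | commit => exact Or.inl rfl
  | _ => exact Or.inr ⟨_, rfl, rfl, rfl⟩

theorem Act.log_cases (h : Act P p t s s') : s'.log = s.log ∨
    ∃ m : Msg Node Tx, m.src = p ∧ m.round = s'.round ∧ s'.log = insert m s.log := by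
  cases h with
  | start w hs ht hw h =>
    subst h
    simpa using startRound_log_cases P p t { s with started := True } 0 w
  | handle hs hd h => exact h.log_cases

theorem Act.log_subset (h : Act P p t s s') : s.log ⊆ s'.log := by
  rcases h.log_cases with h | ⟨m, -, -, h⟩
  · exact h.ge
  · rw [h]; exact Set.subset_insert _ _

theorem Act.started (h : Act P p t s s') : s'.started := by
  cases h with
  | start w hs ht hw h => subst h; simp
  | handle hs hd h => rw [h.started_eq]; exact hs

theorem Handler.advance_or_sameRound (h : Handler P p t s s') :
    Advance P p t s s' ∨ SameRound s s' := by
  rcases h.advance_or_round_eq with ha | hr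
  · exact Or.inl ha
  · refine Or.inr ?_
    cases h with
    | updateRef s₁ _ r v w rr hprop hex hrem hnovalid hshort hw h₁ h₂ =>
      subst h₁
      rcases h₂ with ⟨rfl, rfl⟩ | ⟨h₂, rfl⟩
      · simp at hr
      · exact ⟨rfl, id, id, rfl, fun _ => id, fun _ => id⟩
    | skip r w hlt => simp at hr; omega
    | timeoutPrecommit => simp at hr
    | _ => constructor <;> simp_all +decide [castPrevote, castPrecommit, NodeState.addMsg]

theorem Handler.validRound_mono (h : Handler P p t s s') {x : ℕ} (hx : s.validRound = some x) :
    ∃ y, x ≤ y ∧ s'.validRound = some y := by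
  cases h with
  | updateRef s₁ _ r v w rr hprop hex hrem hnovalid hshort hw h₁ h₂ => simp [hx] at hnovalid
  | updateValid r v rr ref hcert hrecent href => exact ⟨r, (hrecent x hx).le, rfl⟩
  | skip | timeoutPrecommit => exact ⟨x, le_rfl, by simpa using hx⟩
  | _ => exact ⟨x, le_rfl, hx⟩

theorem Handler.lockedRound_cases (h : Handler P p t s s') : s'.lockedRound = s.lockedRound ∨
    (s.phase = .prevote ∧ s'.lockedRound = some s.round ∧
      ∃ v rr, Certified P s s.round v rr) := by
  cases h with
  | updateRef s₁ _ r v w rr hprop hex hrem hnovalid hshort hw h₁ h₂ =>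
    subst h₁
    rcases h₂ with ⟨rfl, rfl⟩ | ⟨h₂, rfl⟩ <;> simp
  | lock v rr hphase hcert => exact Or.inr ⟨hphase, rfl, v, rr, hcert⟩
  | skip | timeoutPrecommit => simp
  | _ => exact Or.inl rfl

theorem Handler.refValue_cases (h : Handler P p t s s') :
    s'.refValue = s.refValue ∨
      ∃ v, s'.refValue = some v ∧ ∀ u, s.refValue = some u → v.length < u.length := by
  cases h with
  | updateRef s₁ _ r v w rr hprop hex hrem hnovalid hshort hw h₁ h₂ =>
    subst h₁
    rcases h₂ with ⟨rfl, rfl⟩ | ⟨h₂, rfl⟩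
    · exact Or.inr ⟨v, by simp, hshort⟩
    · exact Or.inr ⟨v, rfl, hshort⟩
  | skip | timeoutPrecommit => simp
  | _ => exact Or.inl rfl

theorem Act.timerPropose_cases (h : Act P p t s s') {d : ℝ} (hd : s'.timerPropose = some d) :
    (s'.round = s.round ∧ s.timerPropose = some d) ∨ d = t + P.timeoutPropose s'.round := by
  have key : ∀ r w s₁, (startRound P p t r w s₁).timerPropose = some d →
      d = t + P.timeoutPropose r := by
    intro r w s₁ hd
    by_cases hp : P.proposer r = p
    · rw [startRound_timerPropose_of_eq P p t s₁ r w hp] at hd; simp at hd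
    · rw [startRound_timerPropose_of_ne P p t s₁ r w hp] at hd; simpa [eq_comm] using hd
  cases h with
  | start w hs ht hw h => subst h; exact Or.inr (by simpa using key _ _ _ hd)
  | handle hs hdec h =>
    rcases h.advance_or_sameRound with ha | hs
    · obtain ⟨s₁, w, heq⟩ := ha.exists_eq_startRound
      rw [heq] at hd
      exact Or.inr (key _ _ _ hd)
    · exact Or.inl ⟨hs.round, by rw [← hs.timerPropose, hd]⟩

theorem Act.timerPrevote_cases (h : Act P p t s s') {d : ℝ} (hd : s'.timerPrevote = some d) :
    (s'.round = s.round ∧ s.timerPrevote = some d) ∨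
      (s'.round = s.round ∧ s.phase = .prevote ∧ AnyPrevotes P s.log s.round ∧
        d = t + P.timeoutPrevote s.round) := by
  cases h with
  | start w hs ht hw h => subst h; simp at hd
  | handle hs hdec h =>
    cases h with
    | updateRef s₁ _ r v w rr hprop hex hrem hnovalid hshort hw h₁ h₂ =>
      subst h₁
      rcases h₂ with ⟨rfl, rfl⟩ | ⟨h₂, rfl⟩
      · simp at hd
      · exact Or.inl ⟨rfl, hd⟩
    | skip | timeoutPrecommit => simp at hd
    | schedulePrevote hphase hany hfirst =>
      exact Or.inr ⟨rfl, hphase, hany, by simpa [eq_comm] using hd⟩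
    | _ => exact Or.inl ⟨rfl, hd⟩

theorem Act.timerPrecommit_cases (h : Act P p t s s') {d : ℝ}
    (hd : s'.timerPrecommit = some d) :
    (s'.round = s.round ∧ s.timerPrecommit = some d) ∨
      (s'.round = s.round ∧ AnyPrecommits P s.log s.round ∧
        d = t + P.timeoutPrecommit s.round) := by
  cases h with
  | start w hs ht hw h => subst h; simp at hd
  | handle hs hdec h =>
    cases h with
    | updateRef s₁ _ r v w rr hprop hex hrem hnovalid hshort hw h₁ h₂ =>
      subst h₁
      rcases h₂ with ⟨rfl, rfl⟩ | ⟨h₂, rfl⟩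
      · simp at hd
      · exact Or.inl ⟨rfl, hd⟩
    | skip | timeoutPrecommit => simp at hd
    | schedulePrecommit hany hfirst =>
      exact Or.inr ⟨rfl, hany, by simpa [eq_comm] using hd⟩
    | _ => exact Or.inl ⟨rfl, hd⟩

end Actions

/-! ### Invariants of the state of a correct node -/

section Invariants

variable {Node Tx : Type*} [Fintype Node] {P : Params Node Tx} {p : Node} {t : ℝ}
  {s s' : NodeState Node Tx}

/-- The valid value and the reference of a node are backed by the messages in its log. -/
structure Sound (P : Params Node Tx) (s : NodeState Node Tx) : Prop where
  of_some : ∀ x, s.validRound = some x → ∃ v rr y, s.validValue = some v ∧ s.refRound = some y ∧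
    Certified P s x v rr ∧ VerifyEndorsement P s.log y v
  of_none : s.validRound = none → s.validValue = none ∧
    ((s.refRound = none ∧ s.refValue = none) ∨ ∃ r u rr, s.refRound = some r ∧
      s.refValue = some u ∧ Proposed P s.log r u none rr ∧ PrecommitsFor P s.log r u ∧
      ∃ tx ∈ u, Removable P s.log r u tx)

theorem Sound.mono (h : Sound P s) (hL : s.log ⊆ s'.log) (h1 : s'.validValue = s.validValue)
    (h2 : s'.validRound = s.validRound) (h3 : s'.refValue = s.refValue)
    (h4 : s'.refRound = s.refRound) : Sound P s' where
  of_some x hx := by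
    obtain ⟨v, rr, y, hv, hy, hc, he⟩ := h.of_some x (h2 ▸ hx)
    exact ⟨v, rr, y, h1 ▸ hv, h4 ▸ hy, hc.mono hL, he.mono hL⟩
  of_none hx := by
    obtain ⟨hv, h⟩ := h.of_none (h2 ▸ hx)
    refine ⟨h1 ▸ hv, ?_⟩
    rcases h with ⟨h5, h6⟩ | ⟨r, u, rr, h5, h6, hp, hex, tx, htx, hrem⟩
    · exact Or.inl ⟨h4 ▸ h5, h3 ▸ h6⟩
    · exact Or.inr ⟨r, u, rr, h4 ▸ h5, h3 ▸ h6, hL hp, hex.mono hL, tx, htx, hrem.mono hL⟩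

theorem Sound.setRef (h : Sound P s) {r : ℕ} {v : List Tx} {rr : Option ℕ}
    (hprop : Proposed P s.log r v none rr) (hex : PrecommitsFor P s.log r v)
    (hrem : ∃ tx ∈ v, Removable P s.log r v tx) (hnovalid : s.validRound = none) :
    Sound P { s with refRound := some r, refValue := some v } where
  of_some x hx := by
    have hx : s.validRound = some x := hx
    simp [hx] at hnovalid
  of_none hx := ⟨(h.of_none hx).1, Or.inr ⟨r, v, rr, rfl, rfl, hprop, hex, hrem⟩⟩

theorem Sound.startRound (h : Sound P s) (r : ℕ) (w : List Tx) :
    Sound P (startRound P p t r w s) :=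
  h.mono (log_subset_startRound P p t s r w) (by simp) (by simp) (by simp) (by simp)

theorem Handler.sound (h : Handler P p t s s') (hs : Sound P s) : Sound P s' := by
  have hL : s.log ⊆ s'.log := by
    rcases h.log_cases with h | ⟨m, -, -, h⟩
    · exact h.ge
    · rw [h]; exact Set.subset_insert _ _
  cases h with
  | updateRef s₁ _ r v w rr hprop hex hrem hnovalid hshort hw h₁ h₂ =>
    have := hs.setRef hprop hex hrem hnovalid
    subst h₁
    rcases h₂ with ⟨rfl, rfl⟩ | ⟨h₂, rfl⟩
    · exact this.startRound _ _
    · exact this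
  | updateValid r v rr ref hcert hrecent href =>
    refine ⟨fun x hx => ?_, fun hx => by simp at hx⟩
    obtain rfl : r = x := by simpa using hx
    rcases href with ⟨he, rfl⟩ | ⟨hne, rfl⟩
    · exact ⟨v, rr, r, rfl, rfl, hcert, he⟩
    · rcases hcert.2.2.2 with ⟨r', hr', he⟩ | he
      · exact ⟨v, ref, r', rfl, hr', hcert, he⟩
      · exact absurd he hne
  | skip | timeoutPrecommit => exact hs.startRound _ _
  | _ => exact hs.mono hL rfl rfl rfl rfl

/-- Whatever a correct proposer proposes can be checked by means of its own log. -/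
theorem Sound.justified (h : Sound P s) (w : List Tx) :
    Justified P s.log (proposalValue P s w) s.validRound s.refRound := by
  cases hx : s.validRound with
  | some x =>
    obtain ⟨v, rr, y, hv, hy, hc, he⟩ := h.of_some x hx
    refine Or.inr ⟨x, y, rfl, hy, ?_⟩
    have : proposalValue P s w = v := by unfold proposalValue; rw [hv]
    rw [this]
    exact ⟨hc.2.1, he⟩
  | none =>
    obtain ⟨hv, h⟩ := h.of_none hx
    refine Or.inl ⟨rfl, ?_⟩
    rcases h with ⟨h1, -⟩ | ⟨r, u, rr, h1, h2, -, hex, -⟩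
    · exact Or.inl h1
    · refine Or.inr ⟨r, h1, u, hex, ?_⟩
      have : proposalValue P s w = extract P s.log r u := by
        unfold proposalValue; rw [hv, h1, h2]
      rw [this]
      exact ⟨extract_sublist r u, fun tx htx hno => removable_of_notMem_extract htx hno⟩

/-- What always holds of the local state of a correct node. -/
structure Inv (P : Params Node Tx) (p : Node) (s : NodeState Node Tx) : Prop where
  idle : ¬ s.started → s = { NodeState.init Node Tx with log := s.log }
  own : ∀ m ∈ s.log, m.src = p → s.started ∧ m.round ≤ s.round
  timerPropose : s.started → P.proposer s.round ≠ p → ∃ d, s.timerPropose = some d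
  prevote : s.phase = .prevote → ∃ v D, Msg.prevote p s.round v true D ∈ s.log
  precommit : s.phase = .precommit → (∃ v X, Msg.precommit p s.round v X ∈ s.log) ∧
    ((∃ v D, Msg.prevote p s.round v true D ∈ s.log) ∨ ∃ v v' vr rr vr' rr',
      Proposed P s.log s.round v vr rr ∧ Proposed P s.log s.round v' vr' rr' ∧ v ≠ v')
  sound : Sound P s
  proposed : s.started → P.proposer s.round = p → ∃ v vr rr, Proposed P s.log s.round v vr rr ∧
    Justified P s.log v vr rr ∧ vr ≠ some s.round
  decided : ∀ v, s.decision = some v → ∃ r vr rr, Proposed P s.log r v vr rr ∧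
    CommitsFor P s.log r v ∧ P.valid v

theorem Inv.init : Inv P p (NodeState.init Node Tx) where
  idle _ := rfl
  own m hm := by simp [NodeState.init] at hm
  timerPropose h := h.elim
  prevote h := by simp [NodeState.init] at h
  precommit h := by simp [NodeState.init] at h
  sound := ⟨fun x hx => by simp [NodeState.init] at hx, fun _ => ⟨rfl, Or.inl ⟨rfl, rfl⟩⟩⟩
  proposed h := h.elim
  decided v h := by simp [NodeState.init] at h

theorem Inv.addMsg (h : Inv P p s) {m : Msg Node Tx} (hm : m.src = p → m ∈ s.log) :
    Inv P p (s.addMsg m) := by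
  have hL : s.log ⊆ (s.addMsg m).log := Set.subset_insert _ _
  refine ⟨fun hs => ?_, ?_, h.timerPropose, ?_, ?_, h.sound.mono hL rfl rfl rfl rfl, ?_, ?_⟩
  · have := h.idle hs
    generalize hl : s.log = l at this
    subst this
    rfl
  · rintro m' (rfl | hm') hsrc
    · exact h.own _ (hm hsrc) hsrc
    · exact h.own _ hm' hsrc
  · intro hph
    obtain ⟨v, D, hv⟩ := h.prevote hph
    exact ⟨v, D, hL hv⟩
  · intro hph
    obtain ⟨⟨v, X, hv⟩, h2⟩ := h.precommit hph
    refine ⟨⟨v, X, hL hv⟩, ?_⟩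
    rcases h2 with ⟨v, D, hv⟩ | ⟨v, v', vr, rr, vr', rr', h1, h2, h3⟩
    · exact Or.inl ⟨v, D, hL hv⟩
    · exact Or.inr ⟨v, v', vr, rr, vr', rr', hL h1, hL h2, h3⟩
  · intro hs hp
    obtain ⟨v, vr, rr, h1, h2, h3⟩ := h.proposed hs hp
    exact ⟨v, vr, rr, hL h1, h2.mono hL, h3⟩
  · intro v hv
    obtain ⟨r, vr, rr, h1, h2, h3⟩ := h.decided v hv
    exact ⟨r, vr, rr, hL h1, h2.mono hL, h3⟩

theorem inv_startRound {r : ℕ} (w : List Tx) (hst : s.started)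
    (hown : ∀ m ∈ s.log, m.src = p → m.round < r) (hsound : Sound P s)
    (hdec : s.decision = none) : Inv P p (startRound P p t r w s) where
  idle h := by simp [hst] at h
  own m hm hsrc := by
    refine ⟨by simpa using hst, ?_⟩
    rw [startRound_round]
    rcases startRound_log_cases P p t s r w with h | ⟨m', -, hr, h⟩
    · exact (hown m (h ▸ hm) hsrc).le
    · rcases h ▸ hm with rfl | hm
      · exact hr.le
      · exact (hown m hm hsrc).le
  timerPropose _ hp := by
    rw [startRound_round] at hp
    exact ⟨_, startRound_timerPropose_of_ne P p t s r w hp⟩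
  prevote h := by simp at h
  precommit h := by simp at h
  sound := hsound.startRound r w
  proposed _ hp := by
    rw [startRound_round] at hp ⊢
    refine ⟨proposalValue P s w, s.validRound, s.refRound, ?_,
      (hsound.justified w).mono (log_subset_startRound P p t s r w), fun hx => ?_⟩
    · unfold Proposed
      rw [startRound_log_of_eq P p t s r w hp, hp]
      exact Set.mem_insert _ _
    · -- a certificate of round `r` contains a proposal of `p` for that round
      obtain ⟨v, rr, y, -, -, ⟨⟨vr, hprop⟩, -⟩, -⟩ := hsound.of_some r hx
      exact lt_irrefl _ (hown _ hprop hp)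
  decided v hv := by simp [hdec] at hv

theorem Handler.phase_prevote (h : Handler P p t s s') (hph : s'.phase = .prevote) :
    s.phase = .prevote ∨ ∃ v D, Msg.prevote p s.round v true D ∈ s'.log := by
  cases h with
  | updateRef s₁ _ r v w rr hprop hex hrem hnovalid hshort hw h₁ h₂ =>
    subst h₁
    rcases h₂ with ⟨rfl, rfl⟩ | ⟨h₂, rfl⟩
    · simp at hph
    · exact Or.inl hph
  | prevoteNew | rejectNew | rejectUnreferenced | prevoteOld | rejectOld | timeoutPropose =>
    exact Or.inr ⟨_, _, Set.mem_insert _ _⟩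
  | lock | precommitNil | conflict | rapidRemoval | timeoutPrevote | timeoutPrevoteNil =>
    simp [castPrecommit] at hph
  | skip | timeoutPrecommit => simp at hph
  | _ => exact Or.inl hph

theorem Handler.phase_precommit (h : Handler P p t s s') (hph : s'.phase = .precommit) :
    s.phase = .precommit ∨ ((∃ v X, Msg.precommit p s.round v X ∈ s'.log) ∧
      (s.phase = .prevote ∨ ∃ v v' vr rr vr' rr', Proposed P s.log s.round v vr rr ∧
        Proposed P s.log s.round v' vr' rr' ∧ v ≠ v')) := by
  cases h with
  | updateRef s₁ _ r v w rr hprop hex hrem hnovalid hshort hw h₁ h₂ =>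
    subst h₁
    rcases h₂ with ⟨rfl, rfl⟩ | ⟨h₂, rfl⟩
    · simp at hph
    · exact Or.inl hph
  | prevoteNew | rejectNew | rejectUnreferenced | prevoteOld | rejectOld | timeoutPropose =>
    simp [castPrevote] at hph
  | lock _ _ h | precommitNil h | rapidRemoval _ _ h | timeoutPrevote _ _ _ _ _ h
  | timeoutPrevoteNil _ _ _ h =>
    exact Or.inr ⟨⟨_, _, Set.mem_insert _ _⟩, Or.inl h⟩
  | conflict v v' vr rr vr' rr' hphase hprop hprop' hne =>
    exact Or.inr ⟨⟨_, _, Set.mem_insert _ _⟩, Or.inr ⟨v, v', vr, rr, vr', rr', hprop, hprop', hne⟩⟩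
  | skip | timeoutPrecommit => simp at hph
  | _ => exact Or.inl hph

theorem Handler.decision_cases (h : Handler P p t s s') {v : List Tx}
    (hv : s'.decision = some v) : s.decision = some v ∨ ∃ r vr rr, Proposed P s.log r v vr rr ∧
      CommitsFor P s.log r v ∧ P.valid v := by
  cases h with
  | updateRef s₁ _ r v w rr hprop hex hrem hnovalid hshort hw h₁ h₂ =>
    subst h₁
    rcases h₂ with ⟨rfl, rfl⟩ | ⟨h₂, rfl⟩
    · exact Or.inl (by simpa using hv)
    · exact Or.inl hv
  | commit r u vr rr hprop hcommit hvalid =>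
    obtain rfl : u = v := by simpa using hv
    exact Or.inr ⟨r, vr, rr, hprop, hcommit, hvalid⟩
  | skip | timeoutPrecommit => exact Or.inl (by simpa using hv)
  | _ => exact Or.inl hv

theorem Inv.handler (h : Inv P p s) (hst : s.started) (hdec : s.decision = none)
    (ha : Handler P p t s s') : Inv P p s' := by
  have hown : ∀ r, s.round < r → ∀ m ∈ s.log, m.src = p → m.round < r :=
    fun r hr m hm hsrc => (h.own m hm hsrc).2.trans_lt hr
  rcases ha.advance_or_sameRound with hadv | hsame
  · cases hadv with
    | timeout d w htimer hd hw heq =>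
      subst heq
      exact inv_startRound w hst (hown _ (Nat.lt_succ_self _)) h.sound hdec
    | reference v w rr hprop hex hrem hnovalid hshort hw heq =>
      subst heq
      exact inv_startRound w hst (hown _ (Nat.lt_succ_self _))
        (h.sound.setRef hprop hex hrem hnovalid) hdec
    | skip r w hr hmsgs hw heq =>
      subst heq
      exact inv_startRound w hst (hown _ hr) h.sound hdec
  · have hL : s.log ⊆ s'.log := by
      rcases ha.log_cases with h | ⟨m, -, -, h⟩
      · exact h.ge
      · rw [h]; exact Set.subset_insert _ _
    have hprev : s.phase = .prevote → ∃ v D, Msg.prevote p s'.round v true D ∈ s'.log := by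
      intro hph
      obtain ⟨v, D, hv⟩ := h.prevote hph
      exact ⟨v, D, by rw [hsame.round]; exact hL hv⟩
    refine ⟨fun hs => absurd (ha.started_eq ▸ hst) hs, ?_, ?_, ?_, ?_, ha.sound h.sound, ?_, ?_⟩
    · intro m hm hsrc
      refine ⟨ha.started_eq ▸ hst, ?_⟩
      rcases ha.log_cases with hl | ⟨m', -, hr, hl⟩
      · rw [hsame.round]
        exact (h.own m (hl ▸ hm) hsrc).2
      · rcases hl ▸ hm with rfl | hm
        · exact hr.le
        · rw [hsame.round]
          exact (h.own m hm hsrc).2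
    · rw [hsame.round, hsame.timerPropose]
      exact fun _ => h.timerPropose hst
    · intro hph
      rcases ha.phase_prevote hph with hph | ⟨v, D, hv⟩
      · exact hprev hph
      · exact ⟨v, D, by rw [hsame.round]; exact hv⟩
    · intro hph
      rcases ha.phase_precommit hph with hph | ⟨⟨v, X, hv⟩, h2⟩
      · obtain ⟨⟨v, X, hv⟩, h2⟩ := h.precommit hph
        rw [hsame.round]
        refine ⟨⟨v, X, hL hv⟩, ?_⟩
        rcases h2 with ⟨v, D, hv⟩ | ⟨v, v', vr, rr, vr', rr', h1, h2, h3⟩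
        · exact Or.inl ⟨v, D, hL hv⟩
        · exact Or.inr ⟨v, v', vr, rr, vr', rr', hL h1, hL h2, h3⟩
      · refine ⟨⟨v, X, by rw [hsame.round]; exact hv⟩, ?_⟩
        rcases h2 with hph | ⟨v, v', vr, rr, vr', rr', h1, h2, h3⟩
        · exact Or.inl (hprev hph)
        · rw [hsame.round]
          exact Or.inr ⟨v, v', vr, rr, vr', rr', hL h1, hL h2, h3⟩
    · rw [hsame.round]
      intro _ hp
      obtain ⟨v, vr, rr, h1, h2, h3⟩ := h.proposed hst hp
      exact ⟨v, vr, rr, hL h1, h2.mono hL, h3⟩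
    · intro v hv
      rcases ha.decision_cases hv with hv | ⟨r, vr, rr, h1, h2, h3⟩
      · simp [hdec] at hv
      · exact ⟨r, vr, rr, hL h1, h2.mono hL, h3⟩

theorem Inv.act (h : Inv P p s) (ha : Act P p t s s') : Inv P p s' := by
  cases ha with
  | start w hs ht hw heq =>
    subst heq
    have hidle := h.idle hs
    refine inv_startRound w trivial (fun m hm hsrc => absurd (h.own m hm hsrc).1 hs)
      (h.sound.mono subset_rfl rfl rfl rfl rfl) ?_
    change s.decision = none
    rw [hidle]
    rfl
  | handle hs hd h' => exact h.handler hs hd h'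

end Invariants

/-! ### Executions -/

/-- The assumptions on the system and on an execution `c` of it. -/
structure Setting {Node Tx : Type*} [Fintype Node] (P : Params Node Tx) (correct : Set Node)
    (GST Δ : ℝ) (c : ℕ → Config Node Tx) : Prop where
  card : 3 * P.f + 1 ≤ Fintype.card Node
  byzantine : correctᶜ.ncard ≤ P.f
  proposer : ∀ p R, ∃ r, R ≤ r ∧ P.proposer r = p
  valid_nil : P.valid []
  valid_sublist : ∀ u v : List Tx, u.Sublist v → P.valid v → P.valid u
  delta_pos : 0 < Δ
  timeout : ∃ R, ∀ r, R ≤ r → 2 * Δ ≤ P.timeoutPropose r ∧ 2 * Δ ≤ P.timeoutPrevote r ∧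
    2 * Δ ≤ P.timeoutPrecommit r
  exec : IsExecution P correct GST Δ c

/-- Index `j` is the last one before time `X`. As time passes `X` in the next step, no correct node
can act in the configuration `c j` at any time before `X`. -/
structure Cut {Node Tx : Type*} (c : ℕ → Config Node Tx) (X : ℝ) (j : ℕ) : Prop where
  lt : (c j).now < X
  le_succ : X ≤ (c (j + 1)).now

section Executions

variable {Node Tx : Type*} [Fintype Node] {P : Params Node Tx} {correct : Set Node} {GST Δ : ℝ}
  {c : ℕ → Config Node Tx} {p q : Node} {i j k r : ℕ} {X d : ℝ}

namespace Setting

theorem quorum_le (H : Setting P correct GST Δ c) :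
    quorum P + correctᶜ.ncard ≤ Nat.card Node := by
  have h1 := H.card
  have h2 := H.byzantine
  rw [Nat.card_eq_fintype_card]
  unfold quorum
  omega

theorem succ_le (H : Setting P correct GST Δ c) :
    P.f + 1 + correctᶜ.ncard ≤ Nat.card Node := by
  have h1 := H.card
  have h2 := H.byzantine
  rw [Nat.card_eq_fintype_card]
  omega

theorem succ_le_quorum (H : Setting P correct GST Δ c) : P.f + 1 ≤ quorum P := by
  have h1 := H.card
  unfold quorum
  omega

theorem exists_correct (H : Setting P correct GST Δ c) {Q : Node → Prop}
    (h : AtLeast (P.f + 1) Q) : ∃ y ∈ correct, Q y :=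
  h.exists_mem (Nat.lt_succ_of_le H.byzantine)

theorem exists_correct_of_quorum (H : Setting P correct GST Δ c) {Q : Node → Prop}
    (h : AtLeast (quorum P) Q) : ∃ y ∈ correct, Q y :=
  H.exists_correct (h.of_le H.succ_le_quorum)

theorem step_cases (H : Setting P correct GST Δ c) (p : Node) (k : ℕ) :
    (c (k + 1)).node p = (c k).node p ∨
    (∃ m, (c (k + 1)).node p = ((c k).node p).addMsg m ∧
      (m.src ∈ correct → m ∈ ((c k).node m.src).log)) ∨
    (Act P p (c k).now ((c k).node p) ((c (k + 1)).node p) ∧ (c (k + 1)).now = (c k).now) := by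
  have h := H.exec.step k
  generalize hc : c (k + 1) = c' at h
  cases h with
  | receive x m hx hauth =>
    by_cases hxp : p = x
    · subst hxp
      exact Or.inr (Or.inl ⟨m, by simp [Config.set], hauth⟩)
    · exact Or.inl (by simp [Config.set, hxp])
  | act x s' hx hact =>
    by_cases hxp : p = x
    · subst hxp
      exact Or.inr (Or.inr ⟨by simpa [Config.set] using hact, rfl⟩)
    · exact Or.inl (by simp [Config.set, hxp])
  | tick t' ht hidle => exact Or.inl rfl

theorem now_mono (H : Setting P correct GST Δ c) : Monotone fun k => (c k).now := by
  refine monotone_nat_of_le_succ fun k => ?_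
  have h := H.exec.step k
  generalize c (k + 1) = c' at h
  cases h with
  | receive x m hx hauth => exact le_rfl
  | act x s' hx hact => exact le_rfl
  | tick t' ht hidle => exact ht

theorem inv (H : Setting P correct GST Δ c) (hp : p ∈ correct) (k : ℕ) :
    Inv P p ((c k).node p) := by
  induction k with
  | zero => rw [H.exec.init p hp]; exact Inv.init
  | succ k ih =>
    rcases H.step_cases p k with h | ⟨m, h, hauth⟩ | ⟨h, -⟩
    · rw [h]; exact ih
    · rw [h]; exact ih.addMsg fun hm => by subst hm; exact hauth hp
    · exact ih.act h

theorem log_mono (H : Setting P correct GST Δ c) (p : Node) (h : i ≤ k) :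
    ((c i).node p).log ⊆ ((c k).node p).log := by
  induction k, h using Nat.le_induction with
  | base => exact subset_rfl
  | succ k _ ih =>
    refine ih.trans ?_
    rcases H.step_cases p k with h | ⟨m, h, -⟩ | ⟨h, -⟩
    · rw [h]
    · rw [h]; exact Set.subset_insert _ _
    · exact h.log_subset

/-- A message of a correct node is in the log of that node. -/
theorem auth (H : Setting P correct GST Δ c) (hp : p ∈ correct) {m : Msg Node Tx}
    (hm : m ∈ ((c k).node p).log) (hsrc : m.src ∈ correct) : m ∈ ((c k).node m.src).log := by
  induction k with
  | zero => rw [H.exec.init p hp] at hm; exact hm.elim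
  | succ k ih =>
    have hmono : ((c k).node m.src).log ⊆ ((c (k + 1)).node m.src).log :=
      H.log_mono m.src (Nat.le_succ k)
    rcases H.step_cases p k with h | ⟨m', h, hauth⟩ | ⟨h, -⟩
    · exact hmono (ih (h ▸ hm))
    · rw [h] at hm
      rcases hm with rfl | hm
      · exact hmono (hauth hsrc)
      · exact hmono (ih hm)
    · rcases h.log_cases with hl | ⟨m', hm', -, hl⟩
      · exact hmono (ih (hl ▸ hm))
      · rcases hl ▸ hm with rfl | hm1
        · rw [hm']; exact hm
        · exact hmono (ih hm1)

/-- A message that a correct node `y` has sent was added to its log by an action of `y`. -/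
theorem exists_act_of_mem (H : Setting P correct GST Δ c) {m : Msg Node Tx}
    (hsrc : m.src ∈ correct) (hm : m ∈ ((c k).node m.src).log) :
    ∃ i < k, m ∉ ((c i).node m.src).log ∧ m ∈ ((c (i + 1)).node m.src).log ∧
      Act P m.src (c i).now ((c i).node m.src) ((c (i + 1)).node m.src) := by
  induction k with
  | zero => rw [H.exec.init _ hsrc] at hm; exact hm.elim
  | succ k ih =>
    by_cases hk : m ∈ ((c k).node m.src).log
    · obtain ⟨i, hi, h⟩ := ih hk
      exact ⟨i, hi.trans (Nat.lt_succ_self k), h⟩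
    · rcases H.step_cases m.src k with h | ⟨m', h, hauth⟩ | ⟨h, -⟩
      · exact absurd (h ▸ hm) hk
      · have hm2 := hm
        rw [h] at hm2
        rcases hm2 with rfl | hm2
        · exact absurd (hauth hsrc) hk
        · exact absurd hm2 hk
      · exact ⟨k, Nat.lt_succ_self k, hk, hm, h⟩

theorem exists_cut (H : Setting P correct GST Δ c) (h : (c k).now < X) :
    ∃ j, k ≤ j ∧ Cut c X j := by
  classical
  have hex : ∃ i, X ≤ (c (k + i)).now := by
    obtain ⟨N, hN⟩ := Filter.eventually_atTop.1
      (H.exec.time.eventually (Filter.eventually_ge_atTop X))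
    exact ⟨N, hN _ (Nat.le_add_left N k)⟩
  have h1 := Nat.find_spec hex
  have h2 := fun m => Nat.find_min hex (m := m)
  cases hi : Nat.find hex with
  | zero => rw [hi] at h1; exact absurd h1 (not_le.2 h)
  | succ n =>
    rw [hi] at h1
    exact ⟨k + n, Nat.le_add_right k n, not_le.1 (h2 n (by omega)), h1⟩

theorem exists_late_cut (H : Setting P correct GST Δ c) (k : ℕ) (X : ℝ) :
    ∃ Y j, X < Y ∧ k ≤ j ∧ Cut c Y j := by
  obtain ⟨j, hj, hc⟩ := H.exists_cut (k := k) (X := max (c k).now X + 1)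
    (lt_of_le_of_lt (le_max_left _ X) (lt_add_one _))
  exact ⟨_, j, lt_of_le_of_lt (le_max_right (c k).now X) (lt_add_one _), hj, hc⟩

theorem le_cut (H : Setting P correct GST Δ c) (hj : Cut c X j) (h : (c k).now < X) :
    k ≤ j := by
  by_contra hlt
  have := H.now_mono (show j + 1 ≤ k by omega)
  exact absurd (hj.le_succ.trans this) (not_le.2 h)

theorem cut_lt (H : Setting P correct GST Δ c) (hj : Cut c X j) (h : X ≤ (c k).now) : j < k := by
  by_contra hlt
  have : (c k).now ≤ (c j).now := H.now_mono (show k ≤ j by omega)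
  exact absurd (h.trans this) (not_le.2 hj.lt)

theorem not_act_of_cut (H : Setting P correct GST Δ c) (hj : Cut c X j) (hp : p ∈ correct)
    {t : ℝ} (h1 : (c j).now ≤ t) (h2 : t < X) (s' : NodeState Node Tx) :
    ¬ Act P p t ((c j).node p) s' := by
  have h := H.exec.step j
  have h3 := hj.lt.trans_le hj.le_succ
  have h4 := hj.le_succ
  generalize c (j + 1) = c' at h h3 h4
  cases h with
  | receive x m hx hauth => exact absurd h3 (lt_irrefl _)
  | act x s' hx hact => exact absurd h3 (lt_irrefl _)
  | tick t' ht hidle => exact hidle t h1 (h2.trans_le h4) p hp s'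

/-- Gossip spreads the whole log of a correct node to every other correct node. -/
theorem log_subset_of_cut (H : Setting P correct GST Δ c) (hj : Cut c X j) (hp : p ∈ correct)
    (hq : q ∈ correct) (hX : max (c k).now GST + Δ ≤ X) :
    ((c k).node p).log ⊆ ((c j).node q).log := by
  intro m hm
  obtain ⟨i, hi, hlt⟩ := H.exec.gossip k p hp q hq m hm
  exact H.log_mono q (H.le_cut hj (hlt.trans_le hX)) hi

theorem eventually_log_subset (H : Setting P correct GST Δ c) (hp : p ∈ correct)
    (hq : q ∈ correct) (k : ℕ) :
    ∀ᶠ j in Filter.atTop, ((c k).node p).log ⊆ ((c j).node q).log := by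
  obtain ⟨Y, j, hY, -, hj⟩ := H.exists_late_cut k (max (c k).now GST + Δ)
  filter_upwards [Filter.eventually_ge_atTop j] with i hi
  exact (H.log_subset_of_cut hj hp hq hY.le).trans (H.log_mono q hi)

theorem started_mono (H : Setting P correct GST Δ c) (p : Node) (h : i ≤ k)
    (hs : ((c i).node p).started) : ((c k).node p).started := by
  induction k, h using Nat.le_induction with
  | base => exact hs
  | succ k _ ih =>
    rcases H.step_cases p k with h | ⟨m, h, -⟩ | ⟨h, -⟩
    · rw [h]; exact ih
    · rw [h]; exact ih
    · exact h.started

theorem eventually_started (H : Setting P correct GST Δ c) :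
    ∀ᶠ k in Filter.atTop, ∀ p ∈ correct, ((c k).node p).started := by
  refine (Filter.eventually_all_finite (Set.toFinite correct)).2 fun p hp => ?_
  obtain ⟨Y, j, hY, -, hj⟩ := H.exists_late_cut 0 (P.startTime p)
  filter_upwards [Filter.eventually_ge_atTop j] with k hk
  refine H.started_mono p hk ?_
  by_contra hs
  exact H.not_act_of_cut hj hp (t := max (P.startTime p) (c j).now) (le_max_right _ _)
    (max_lt hY hj.lt) _ (.start [] hs (le_max_left _ _) H.valid_nil rfl)

theorem started_of_round (H : Setting P correct GST Δ c) (hp : p ∈ correct)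
    (h : 0 < ((c k).node p).round) : ((c k).node p).started := by
  by_contra hs
  rw [(H.inv hp k).idle hs] at h
  exact absurd h (lt_irrefl 0)

theorem step_round (H : Setting P correct GST Δ c) (p : Node)
    (hs : ((c k).node p).started) :
    Advance P p (c k).now ((c k).node p) ((c (k + 1)).node p) ∨
    SameRound ((c k).node p) ((c (k + 1)).node p) := by
  rcases H.step_cases p k with h | ⟨m, h, -⟩ | ⟨h, -⟩
  · rw [h]; exact Or.inr (SameRound.refl _)
  · rw [h]; exact Or.inr ⟨rfl, id, id, rfl, fun _ => id, fun _ => id⟩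
  · cases h with
    | start w hs' => exact absurd hs hs'
    | handle hs' hd h => exact h.advance_or_sameRound

theorem round_mono (H : Setting P correct GST Δ c) (hp : p ∈ correct) (h : i ≤ k) :
    ((c i).node p).round ≤ ((c k).node p).round := by
  induction k, h using Nat.le_induction with
  | base => exact le_rfl
  | succ k _ ih =>
    refine ih.trans ?_
    rcases Nat.eq_zero_or_pos ((c k).node p).round with h0 | hpos
    · rw [h0]; exact Nat.zero_le _
    · rcases H.step_round p (H.started_of_round hp hpos) with h | h
      · exact h.round_lt.le
      · exact h.round.ge

theorem sameRound (H : Setting P correct GST Δ c) (hp : p ∈ correct) (h : i ≤ k)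
    (hs : ((c i).node p).started) (hr : ((c k).node p).round ≤ ((c i).node p).round) :
    SameRound ((c i).node p) ((c k).node p) := by
  induction k, h using Nat.le_induction with
  | base => exact SameRound.refl _
  | succ k hk ih =>
    have h1 := H.round_mono hp hk
    have h2 := H.round_mono hp (Nat.le_succ k)
    refine (ih (h2.trans hr)).trans ?_
    rcases H.step_round p (H.started_mono p hk hs) with h | h
    · have := h.round_lt; omega
    · exact h

theorem exists_advance (H : Setting P correct GST Δ c) (hp : p ∈ correct) (hr : 0 < r)
    (h : r ≤ ((c k).node p).round) : ∃ i < k, ((c i).node p).round < r ∧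
      r ≤ ((c (i + 1)).node p).round ∧ (c (i + 1)).now = (c i).now ∧
      Advance P p (c i).now ((c i).node p) ((c (i + 1)).node p) := by
  induction k with
  | zero => rw [H.exec.init p hp] at h; exact absurd h (not_le.2 hr)
  | succ k ih =>
    by_cases hk : r ≤ ((c k).node p).round
    · obtain ⟨i, hi, h'⟩ := ih hk
      exact ⟨i, hi.trans (Nat.lt_succ_self k), h'⟩
    · refine ⟨k, Nat.lt_succ_self k, not_le.1 hk, h, ?_⟩
      rcases H.step_cases p k with h' | ⟨m, h', -⟩ | ⟨h', ht⟩
      · rw [h'] at h; exact absurd h hk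
      · rw [h'] at h; exact absurd h hk
      · refine ⟨ht, ?_⟩
        cases h' with
        | start w hs ht hw heq => rw [heq, startRound_round] at h; omega
        | handle hs hd h' =>
          rcases h'.advance_or_sameRound with ha | hs
          · exact ha
          · rw [hs.round] at h; exact absurd h hk

/-- When a node left the propose phase of its current round. -/
theorem exists_leave_propose (H : Setting P correct GST Δ c) (hp : p ∈ correct)
    (h : ((c k).node p).phase ≠ .propose) : ∃ i < k,
      ((c i).node p).round = ((c k).node p).round ∧ ((c i).node p).phase = .propose ∧
      ((c (i + 1)).node p).phase ≠ .propose ∧ ((c i).node p).started ∧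
      Handler P p (c i).now ((c i).node p) ((c (i + 1)).node p) := by
  induction k with
  | zero => rw [H.exec.init p hp] at h; exact absurd rfl h
  | succ k ih =>
    rcases H.step_cases p k with h' | ⟨m, h', -⟩ | ⟨h', ht⟩
    · rw [h'] at h ⊢
      obtain ⟨i, hi, h1⟩ := ih h
      exact ⟨i, hi.trans (Nat.lt_succ_self k), h1⟩
    · rw [h'] at h ⊢
      obtain ⟨i, hi, h1⟩ := ih h
      exact ⟨i, hi.trans (Nat.lt_succ_self k), h1⟩
    · cases h' with
      | start w hs ht hw heq => rw [heq, startRound_phase] at h; exact absurd rfl h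
      | handle hs hd h' =>
        rcases h'.advance_or_sameRound with ha | hsame
        · obtain ⟨s₁, w, heq⟩ := ha.exists_eq_startRound
          rw [heq, startRound_phase] at h
          exact absurd rfl h
        · rw [hsame.round]
          by_cases hk : ((c k).node p).phase = .propose
          · exact ⟨k, Nat.lt_succ_self k, rfl, hk, h, hs, h'⟩
          · obtain ⟨i, hi, h1⟩ := ih hk
            exact ⟨i, hi.trans (Nat.lt_succ_self k), h1⟩

/-- When a node came to the precommit phase of its current round. -/
theorem exists_enter_precommit (H : Setting P correct GST Δ c) (hp : p ∈ correct)
    (h : ((c k).node p).phase = .precommit) : ∃ i < k,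
      ((c i).node p).round = ((c k).node p).round ∧ ((c i).node p).phase ≠ .precommit ∧
      ((c (i + 1)).node p).phase = .precommit ∧
      Handler P p (c i).now ((c i).node p) ((c (i + 1)).node p) := by
  induction k with
  | zero => rw [H.exec.init p hp] at h; simp [NodeState.init] at h
  | succ k ih =>
    rcases H.step_cases p k with h' | ⟨m, h', -⟩ | ⟨h', ht⟩
    · rw [h'] at h ⊢
      obtain ⟨i, hi, h1⟩ := ih h
      exact ⟨i, hi.trans (Nat.lt_succ_self k), h1⟩
    · rw [h'] at h ⊢
      obtain ⟨i, hi, h1⟩ := ih h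
      exact ⟨i, hi.trans (Nat.lt_succ_self k), h1⟩
    · cases h' with
      | start w hs ht hw heq => rw [heq, startRound_phase] at h; simp at h
      | handle hs hd h' =>
        rcases h'.advance_or_sameRound with ha | hsame
        · obtain ⟨s₁, w, heq⟩ := ha.exists_eq_startRound
          rw [heq, startRound_phase] at h
          simp at h
        · rw [hsame.round]
          by_cases hk : ((c k).node p).phase = .precommit
          · obtain ⟨i, hi, h1⟩ := ih hk
            exact ⟨i, hi.trans (Nat.lt_succ_self k), h1⟩
          · exact ⟨k, Nat.lt_succ_self k, rfl, hk, h, h'⟩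

/-- A propose timer was started when the node entered its round. -/
theorem timerPropose_origin (H : Setting P correct GST Δ c) (hp : p ∈ correct)
    (hr : 0 < ((c k).node p).round) (hd : ((c k).node p).timerPropose = some d) :
    ∃ i < k, ((c i).node p).round < ((c k).node p).round ∧
      ((c (i + 1)).node p).round = ((c k).node p).round ∧
      (c (i + 1)).now = (c i).now ∧
      d = (c i).now + P.timeoutPropose ((c k).node p).round := by
  induction k with
  | zero => rw [H.exec.init p hp] at hr; exact absurd hr (lt_irrefl 0)
  | succ k ih =>
    rcases H.step_cases p k with h' | ⟨m, h', -⟩ | ⟨h', ht⟩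
    · rw [h'] at hr hd ⊢
      obtain ⟨i, hi, h1⟩ := ih hr hd
      exact ⟨i, hi.trans (Nat.lt_succ_self k), h1⟩
    · rw [h'] at hr hd ⊢
      obtain ⟨i, hi, h1⟩ := ih hr hd
      exact ⟨i, hi.trans (Nat.lt_succ_self k), h1⟩
    · by_cases hrk : ((c (k + 1)).node p).round = ((c k).node p).round
      · have hd' : ((c k).node p).timerPropose = some d := by
          cases h' with
          | start w hs ht hw heq =>
            rw [heq, startRound_round] at hr
            exact absurd hr (lt_irrefl 0)
          | handle hs hdec h =>
            rcases h.advance_or_sameRound with ha | hsame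
            · exact absurd hrk ha.round_lt.ne'
            · rw [← hsame.timerPropose, hd]
        rw [hrk] at hr ⊢
        obtain ⟨i, hi, h1⟩ := ih hr hd'
        exact ⟨i, hi.trans (Nat.lt_succ_self k), h1⟩
      · refine ⟨k, Nat.lt_succ_self k, ?_, rfl, ht, ?_⟩
        · exact lt_of_le_of_ne (H.round_mono hp (Nat.le_succ k)) (Ne.symm hrk)
        · rcases h'.timerPropose_cases hd with ⟨h1, -⟩ | h1
          · exact absurd h1 hrk
          · exact h1

theorem timerPrevote_origin (H : Setting P correct GST Δ c) (hp : p ∈ correct)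
    (hd : ((c k).node p).timerPrevote = some d) :
    ∃ i < k, ((c i).node p).round = ((c k).node p).round ∧ ((c i).node p).phase = .prevote ∧
      AnyPrevotes P ((c i).node p).log ((c k).node p).round ∧
      d = (c i).now + P.timeoutPrevote ((c k).node p).round := by
  induction k with
  | zero => rw [H.exec.init p hp] at hd; simp [NodeState.init] at hd
  | succ k ih =>
    rcases H.step_cases p k with h' | ⟨m, h', -⟩ | ⟨h', ht⟩
    · rw [h'] at hd ⊢
      obtain ⟨i, hi, h1⟩ := ih hd
      exact ⟨i, hi.trans (Nat.lt_succ_self k), h1⟩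
    · rw [h'] at hd ⊢
      obtain ⟨i, hi, h1⟩ := ih hd
      exact ⟨i, hi.trans (Nat.lt_succ_self k), h1⟩
    · rcases h'.timerPrevote_cases hd with ⟨h1, h2⟩ | ⟨h1, h2, h3, h4⟩
      · rw [h1]
        obtain ⟨i, hi, h1⟩ := ih h2
        exact ⟨i, hi.trans (Nat.lt_succ_self k), h1⟩
      · rw [h1]
        exact ⟨k, Nat.lt_succ_self k, rfl, h2, h3, h4⟩

theorem timerPrecommit_origin (H : Setting P correct GST Δ c) (hp : p ∈ correct)
    (hd : ((c k).node p).timerPrecommit = some d) :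
    ∃ i < k, ((c i).node p).round = ((c k).node p).round ∧
      AnyPrecommits P ((c i).node p).log ((c k).node p).round ∧
      d = (c i).now + P.timeoutPrecommit ((c k).node p).round := by
  induction k with
  | zero => rw [H.exec.init p hp] at hd; simp [NodeState.init] at hd
  | succ k ih =>
    rcases H.step_cases p k with h' | ⟨m, h', -⟩ | ⟨h', ht⟩
    · rw [h'] at hd ⊢
      obtain ⟨i, hi, h1⟩ := ih hd
      exact ⟨i, hi.trans (Nat.lt_succ_self k), h1⟩
    · rw [h'] at hd ⊢
      obtain ⟨i, hi, h1⟩ := ih hd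
      exact ⟨i, hi.trans (Nat.lt_succ_self k), h1⟩
    · rcases h'.timerPrecommit_cases hd with ⟨h1, h2⟩ | ⟨h1, h2, h3⟩
      · rw [h1]
        obtain ⟨i, hi, h1⟩ := ih h2
        exact ⟨i, hi.trans (Nat.lt_succ_self k), h1⟩
      · rw [h1]
        exact ⟨k, Nat.lt_succ_self k, rfl, h2, h3⟩

theorem validRound_mono (H : Setting P correct GST Δ c) (p : Node) (h : i ≤ k) {x : ℕ}
    (hx : ((c i).node p).validRound = some x) :
    ∃ y, x ≤ y ∧ ((c k).node p).validRound = some y := by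
  induction k, h using Nat.le_induction with
  | base => exact ⟨x, le_rfl, hx⟩
  | succ k hk ih =>
    obtain ⟨y, hy, hy'⟩ := ih
    rcases H.step_cases p k with h | ⟨m, h, -⟩ | ⟨h, -⟩
    · rw [h]; exact ⟨y, hy, hy'⟩
    · rw [h]; exact ⟨y, hy, hy'⟩
    · cases h with
      | start w hs ht hw heq => rw [heq]; exact ⟨y, hy, by simpa using hy'⟩
      | handle hs hd h =>
        obtain ⟨z, hz, hz'⟩ := h.validRound_mono hy'
        exact ⟨z, hy.trans hz, hz'⟩

/-- A lock stems from a round in whose prevote phase the node held a certificate. -/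
theorem lockedRound_origin (H : Setting P correct GST Δ c) (hp : p ∈ correct) {x : ℕ}
    (hx : ((c k).node p).lockedRound = some x) : ∃ i < k, ((c i).node p).round = x ∧
      ((c i).node p).phase = .prevote ∧ ∃ v rr, Certified P ((c i).node p) x v rr := by
  induction k with
  | zero => rw [H.exec.init p hp] at hx; simp [NodeState.init] at hx
  | succ k ih =>
    have lift : ((c k).node p).lockedRound = some x → ∃ i < k + 1, ((c i).node p).round = x ∧
        ((c i).node p).phase = .prevote ∧ ∃ v rr, Certified P ((c i).node p) x v rr := by
      intro h
      obtain ⟨i, hi, h1⟩ := ih h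
      exact ⟨i, hi.trans (Nat.lt_succ_self k), h1⟩
    rcases H.step_cases p k with h' | ⟨m, h', -⟩ | ⟨h', ht⟩
    · exact lift (h' ▸ hx)
    · exact lift (by rw [h'] at hx; exact hx)
    · cases h' with
      | start w hs ht hw heq => exact lift (by rw [heq] at hx; simpa using hx)
      | handle hs hd h =>
        rcases h.lockedRound_cases with h | ⟨h1, h2, v, rr, h3⟩
        · exact lift (h ▸ hx)
        · obtain rfl : ((c k).node p).round = x := by rw [h2] at hx; simpa using hx
          exact ⟨k, Nat.lt_succ_self k, rfl, h1, v, rr, h3⟩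

end Setting

end Executions

/-! ### Rounds advance as long as no correct node decides -/

/-- An execution in which no correct node ever decides. -/
structure Undecided {Node Tx : Type*} [Fintype Node] (P : Params Node Tx) (correct : Set Node)
    (GST Δ : ℝ) (c : ℕ → Config Node Tx) : Prop extends Setting P correct GST Δ c where
  undecided : ∀ k, ∀ p ∈ correct, ((c k).node p).decision = none

section Liveness

variable {Node Tx : Type*} [Fintype Node] {P : Params Node Tx} {correct : Set Node} {GST Δ : ℝ}
  {c : ℕ → Config Node Tx} {p q : Node} {i j k r : ℕ} {X d : ℝ}

/-- Once a correct node has decided, gossip makes every correct node decide. -/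
theorem Setting.exists_decision (H : Setting P correct GST Δ c) (hp : p ∈ correct)
    (hq : q ∈ correct) {v : List Tx} (hv : ((c k).node p).decision = some v) :
    ∃ j u, ((c j).node q).decision = some u := by
  obtain ⟨r, vr, rr, h1, h2, h3⟩ := (H.inv hp k).decided v hv
  obtain ⟨K, hK⟩ := Filter.eventually_atTop.1
    (H.eventually_started.and (H.eventually_log_subset hp hq k))
  obtain ⟨Y, j, -, hj, hcut⟩ := H.exists_late_cut K 0
  obtain ⟨hs, hL⟩ := hK j hj
  refine ⟨j, ?_⟩
  by_contra! hno
  have hno : ((c j).node q).decision = none := Option.eq_none_iff_forall_ne_some.2 hno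
  exact H.not_act_of_cut hcut hq le_rfl hcut.lt _
    (.handle (hs q hq) hno (.commit _ r v vr rr (hL h1) (h2.mono hL) h3))

theorem Setting.decision_mono (H : Setting P correct GST Δ c) (p : Node) (h : i ≤ k)
    {v : List Tx} (hv : ((c i).node p).decision = some v) :
    ((c k).node p).decision = some v := by
  induction k, h using Nat.le_induction with
  | base => exact hv
  | succ k _ ih =>
    rcases H.step_cases p k with h | ⟨m, h, -⟩ | ⟨h, -⟩
    · rw [h]; exact ih
    · rw [h]; exact ih
    · cases h with
      | start w hs ht hw heq => rw [heq]; simpa using ih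
      | handle hs hd h => rw [hd] at ih; simp at ih

namespace Undecided

/-- No handler of a correct node is enabled before the time of a cut. -/
theorem not_handler (U : Undecided P correct GST Δ c) (hj : Cut c X j) (hp : p ∈ correct)
    (hs : ((c j).node p).started) {t : ℝ} (h1 : (c j).now ≤ t) (h2 : t < X) :
    ¬ ∃ s', Handler P p t ((c j).node p) s' :=
  fun ⟨s', h⟩ => U.not_act_of_cut hj hp h1 h2 s' (.handle hs (U.undecided j p hp) h)

theorem not_skip (U : Undecided P correct GST Δ c) (hj : Cut c X j) (hp : p ∈ correct)
    (hs : ((c j).node p).started)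
    (hmsgs : AtLeast (P.f + 1) fun y => ∃ m ∈ ((c j).node p).log, m.src = y ∧ m.round = r) :
    r ≤ ((c j).node p).round :=
  not_lt.1 fun hr => U.not_handler hj hp hs le_rfl hj.lt
    ⟨_, .skip _ r [] hr hmsgs U.valid_nil⟩

theorem le_round_of_anyPrecommits (U : Undecided P correct GST Δ c) (hj : Cut c X j)
    (hp : p ∈ correct) (hs : ((c j).node p).started)
    (hany : AnyPrecommits P ((c j).node p).log r) : r ≤ ((c j).node p).round :=
  U.not_skip hj hp hs ((hany.of_le U.succ_le_quorum).imp fun _ ⟨_, _, hm⟩ => ⟨_, hm, rfl, rfl⟩)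

theorem exists_timerPrecommit (U : Undecided P correct GST Δ c) (hj : Cut c X j)
    (hp : p ∈ correct) (hs : ((c j).node p).started)
    (hany : AnyPrecommits P ((c j).node p).log ((c j).node p).round) :
    ∃ d, ((c j).node p).timerPrecommit = some d := by
  by_contra! hno
  exact U.not_handler hj hp hs le_rfl hj.lt
    ⟨_, .schedulePrecommit _ hany (Option.eq_none_iff_forall_ne_some.2 hno)⟩

theorem exists_timerPrevote (U : Undecided P correct GST Δ c) (hj : Cut c X j)
    (hp : p ∈ correct) (hs : ((c j).node p).started) (hph : ((c j).node p).phase = .prevote)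
    (hany : AnyPrevotes P ((c j).node p).log ((c j).node p).round) :
    ∃ d, ((c j).node p).timerPrevote = some d := by
  by_contra! hno
  exact U.not_handler hj hp hs le_rfl hj.lt
    ⟨_, .schedulePrevote _ hph hany (Option.eq_none_iff_forall_ne_some.2 hno)⟩

theorem le_timerPrecommit (U : Undecided P correct GST Δ c) (hj : Cut c X j) (hp : p ∈ correct)
    (hs : ((c j).node p).started) (hd : ((c j).node p).timerPrecommit = some d) : X ≤ d :=
  not_lt.1 fun hlt => U.not_handler hj hp hs (le_max_left _ d) (max_lt hj.lt hlt)
    ⟨_, .timeoutPrecommit _ d [] hd (le_max_right _ _) U.valid_nil⟩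

theorem le_timerPrevote (U : Undecided P correct GST Δ c) (hj : Cut c X j) (hp : p ∈ correct)
    (hs : ((c j).node p).started) (hph : ((c j).node p).phase = .prevote)
    (hd : ((c j).node p).timerPrevote = some d) : X ≤ d :=
  not_lt.1 fun hlt => U.not_handler hj hp hs (le_max_left _ d) (max_lt hj.lt hlt)
    (exists_handler_of_timerPrevote p hph hd (le_max_right _ _))

theorem le_timerPropose (U : Undecided P correct GST Δ c) (hj : Cut c X j) (hp : p ∈ correct)
    (hs : ((c j).node p).started) (hph : ((c j).node p).phase = .propose)
    (hd : ((c j).node p).timerPropose = some d) : X ≤ d :=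
  not_lt.1 fun hlt => U.not_handler hj hp hs (le_max_left _ d) (max_lt hj.lt hlt)
    ⟨_, .timeoutPropose _ d hd (le_max_right _ _) hph⟩

/-- A correct proposer leaves the propose phase at once: although it starts no timer, it can check
its own proposal, or else it knows of a later round and skips to it. -/
theorem proposer_phase_ne (U : Undecided P correct GST Δ c) (hj : Cut c X j) (hp : p ∈ correct)
    (hs : ((c j).node p).started) (hpr : P.proposer ((c j).node p).round = p) :
    ((c j).node p).phase ≠ .propose := by
  intro hph
  obtain ⟨v, vr, rr, h1, h2, h3⟩ := (U.inv hp j).proposed hs hpr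
  refine U.not_handler hj hp hs le_rfl hj.lt (exists_handler_of_justified p _ hph h1 h2 ?_)
  rintro x rfl
  rcases h2 with ⟨h2, -⟩ | ⟨x', y, hx, -, hqc, -⟩
  · simp at h2
  · obtain rfl : x = x' := by simpa using hx
    refine lt_of_le_of_ne (U.not_skip hj hp hs ?_) fun h => h3 (by rw [h])
    exact (hqc.of_le U.succ_le_quorum).imp fun _ ⟨_, hm⟩ => ⟨_, hm, rfl, rfl⟩

/-- The first correct node that gets beyond round `r` has seen a quorum of precommits of round
`r`. -/
theorem exists_anyPrecommits (U : Undecided P correct GST Δ c) (hp : p ∈ correct)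
    (h : r < ((c k).node p).round) :
    ∃ i, ∃ q ∈ correct, AnyPrecommits P ((c i).node q).log r := by
  classical
  have hex : ∃ k, ∃ q ∈ correct, r < ((c k).node q).round := ⟨k, p, hp, h⟩
  obtain ⟨q, hq, hlt⟩ := Nat.find_spec hex
  have hmin : ∀ m < Nat.find hex, ∀ y ∈ correct, ((c m).node y).round ≤ r := by
    intro m hm y hy
    by_contra hlt
    exact Nat.find_min hex hm ⟨y, hy, not_le.1 hlt⟩
  obtain ⟨i, hi, hr1, hr2, -, hadv⟩ := U.exists_advance hq (Nat.succ_pos r) hlt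
  refine ⟨i, q, hq, ?_⟩
  cases hadv with
  | timeout d w htimer hd hw heq =>
    rw [heq, startRound_round] at hr2
    obtain ⟨i', hi', hr', hany, -⟩ := U.timerPrecommit_origin hq htimer
    rw [show ((c i).node q).round = r by omega] at hany
    exact hany.mono (U.log_mono q hi'.le)
  | reference v w rr hprop hex' hrem hnovalid hshort hw heq =>
    rw [heq, startRound_round] at hr2
    rw [show ((c i).node q).round = r by omega] at hex'
    exact hex'.any
  | skip r' w hr hmsgs hw heq =>
    rw [heq, startRound_round] at hr2
    obtain ⟨y, hy, m, hm, rfl, hmr⟩ := U.exists_correct hmsgs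
    have h1 := ((U.inv hy i).own m (U.auth hq hm hy) rfl).2
    have h2 := hmin i hi _ hy
    omega

theorem eventually_anyPrecommits (U : Undecided P correct GST Δ c) (hp : p ∈ correct)
    (h : AnyPrecommits P ((c k).node p).log r) :
    ∀ᶠ j in Filter.atTop, ∀ q ∈ correct, AnyPrecommits P ((c j).node q).log r := by
  refine (Filter.eventually_all_finite (Set.toFinite correct)).2 fun q hq => ?_
  exact (U.eventually_log_subset hp hq k).mono fun j hj => h.mono hj

theorem eventually_lt_round (U : Undecided P correct GST Δ c) (hp : p ∈ correct)
    (h : AnyPrecommits P ((c k).node p).log r) :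
    ∀ᶠ j in Filter.atTop, ∀ q ∈ correct, r < ((c j).node q).round := by
  refine (Filter.eventually_all_finite (Set.toFinite correct)).2 fun q hq => ?_
  obtain ⟨K, hK⟩ := Filter.eventually_atTop.1
    (U.eventually_started.and (U.eventually_anyPrecommits hp h))
  obtain ⟨Y, j, -, hj, hcut⟩ := U.exists_late_cut K 0
  have hs := (hK j hj).1 q hq
  have hany := (hK j hj).2 q hq
  have hge := U.le_round_of_anyPrecommits hcut hq hs hany
  suffices ∃ i, r < ((c i).node q).round by
    obtain ⟨i, hi⟩ := this
    filter_upwards [Filter.eventually_ge_atTop i] with m hm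
    exact hi.trans_le (U.round_mono hq hm)
  by_contra! hno
  have hr : ((c j).node q).round = r := le_antisymm (hno j) hge
  obtain ⟨d, hd⟩ := U.exists_timerPrecommit hcut hq hs (by rw [hr]; exact hany)
  obtain ⟨Y', j', hY', hj', hcut'⟩ := U.exists_late_cut j d
  have hsame := U.sameRound hq hj' hs (by rw [hr]; exact hno j')
  exact absurd (U.le_timerPrecommit hcut' hq (U.started_mono q hj' hs)
    (hsame.timerPrecommit d hd)) (not_le.2 hY')

theorem rounds_tendsto (U : Undecided P correct GST Δ c) (r : ℕ) :
    ∀ᶠ k in Filter.atTop, ∀ q ∈ correct, r ≤ ((c k).node q).round := by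
  induction r with
  | zero => exact Filter.Eventually.of_forall fun k q _ => Nat.zero_le _
  | succ r ih =>
    by_contra hno
    -- otherwise every correct node stays in round `r`
    have hle : ∀ k, ∀ q ∈ correct, ((c k).node q).round ≤ r := by
      intro k q hq
      by_contra hlt
      obtain ⟨i, y, hy, hany⟩ := U.exists_anyPrecommits hq (not_le.1 hlt)
      exact hno (U.eventually_lt_round hy hany)
    obtain ⟨K, hK⟩ := Filter.eventually_atTop.1 (U.eventually_started.and ih)
    have hs : ∀ k, K ≤ k → ∀ q ∈ correct, ((c k).node q).started := fun k hk => (hK k hk).1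
    have hr : ∀ k, K ≤ k → ∀ q ∈ correct, ((c k).node q).round = r :=
      fun k hk q hq => le_antisymm (hle k q hq) ((hK k hk).2 q hq)
    have hsame : ∀ i k, K ≤ i → i ≤ k → ∀ q ∈ correct,
        SameRound ((c i).node q) ((c k).node q) := fun i k hi hik q hq =>
      U.sameRound hq hik (hs i hi q hq) (by rw [hr i hi q hq, hr k (hi.trans hik) q hq])
    have hpropose : ∀ q ∈ correct, ∃ k, K ≤ k ∧ ((c k).node q).phase ≠ .propose := by
      intro q hq
      by_cases hpr : P.proposer r = q
      · obtain ⟨Y, j, -, hj, hcut⟩ := U.exists_late_cut K 0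
        exact ⟨j, hj, U.proposer_phase_ne hcut hq (hs j hj q hq) (by rw [hr j hj q hq, hpr])⟩
      · obtain ⟨d, hd⟩ := (U.inv hq K).timerPropose (hs K le_rfl q hq)
          (by rw [hr K le_rfl q hq]; exact hpr)
        obtain ⟨Y, j, hY, hj, hcut⟩ := U.exists_late_cut K d
        refine ⟨j, hj, fun hph => absurd hY (not_lt.2 ?_)⟩
        exact U.le_timerPropose hcut hq (hs j hj q hq) hph
          ((hsame K j le_rfl hj q hq).timerPropose.trans hd)
    have hprecommit : ∀ q ∈ correct, ∃ k, K ≤ k ∧ ((c k).node q).phase = .precommit := by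
      intro q hq
      by_contra! hnever
      obtain ⟨K₁, hK₁, hph⟩ := hpropose q hq
      have hprevote : ∀ k, K₁ ≤ k → ((c k).node q).phase = .prevote := by
        intro k hk
        have h1 := hnever k (hK₁.trans hk)
        have h2 := mt (hsame K₁ k hK₁ hk q hq).propose hph
        cases h : ((c k).node q).phase <;> simp_all
      -- a correct node that has not prevoted has seen two different proposals
      have hvotes : ∀ y ∈ correct, ∃ k v D, Msg.prevote y r v true D ∈ ((c k).node y).log := by
        intro y hy
        obtain ⟨k, hk, hphy⟩ := hpropose y hy
        cases h : ((c k).node y).phase with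
        | propose => exact absurd h hphy
        | prevote =>
          obtain ⟨v, D, hv⟩ := (U.inv hy k).prevote h
          exact ⟨k, v, D, hr k hk y hy ▸ hv⟩
        | precommit =>
          rcases ((U.inv hy k).precommit h).2 with ⟨v, D, hv⟩ |
            ⟨v, v', vr, rr, vr', rr', h1, h2, h3⟩
          · exact ⟨k, v, D, hr k hk y hy ▸ hv⟩
          · exfalso
            obtain ⟨K₂, hK₂⟩ := Filter.eventually_atTop.1 (U.eventually_log_subset hy hq k)
            obtain ⟨Y, j, -, hj, hcut⟩ := U.exists_late_cut (max K₁ K₂) 0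
            have hj1 : K₁ ≤ j := (le_max_left _ _).trans hj
            have hL := hK₂ j ((le_max_right _ _).trans hj)
            have hrj := hr j (hK₁.trans hj1) q hq
            rw [hr k hk y hy] at h1 h2
            exact U.not_handler hcut hq (hs j (hK₁.trans hj1) q hq) le_rfl hcut.lt
              ⟨_, .conflict _ v v' vr rr vr' rr' (by simp [hprevote j hj1])
                (by rw [hrj]; exact hL h1) (by rw [hrj]; exact hL h2) h3⟩
      have hany : ∀ᶠ k in Filter.atTop, ∀ y ∈ correct,
          ∃ v D, Msg.prevote y r v true D ∈ ((c k).node q).log := by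
        refine (Filter.eventually_all_finite (Set.toFinite correct)).2 fun y hy => ?_
        obtain ⟨k, v, D, hv⟩ := hvotes y hy
        exact (U.eventually_log_subset hy hq k).mono fun j hj => ⟨v, D, hj hv⟩
      obtain ⟨K₂, hK₂⟩ := Filter.eventually_atTop.1 hany
      obtain ⟨Y, j, -, hj, hcut⟩ := U.exists_late_cut (max K₁ K₂) 0
      have hj1 : K₁ ≤ j := (le_max_left _ _).trans hj
      have hsj := hs j (hK₁.trans hj1) q hq
      obtain ⟨d, hd⟩ := U.exists_timerPrevote hcut hq hsj (hprevote j hj1) (by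
        rw [hr j (hK₁.trans hj1) q hq]
        exact AtLeast.of_forall_mem U.quorum_le (hK₂ j ((le_max_right _ _).trans hj)))
      obtain ⟨Y', j', hY', hj', hcut'⟩ := U.exists_late_cut j d
      exact absurd (U.le_timerPrevote hcut' hq (U.started_mono q hj' hsj)
        (hprevote j' (hj1.trans hj'))
        ((hsame j j' (hK₁.trans hj1) hj' q hq).timerPrevote d hd)) (not_le.2 hY')
    by_cases hne : ∃ q, q ∈ correct
    · obtain ⟨q, hq⟩ := hne
      have hany : ∀ᶠ k in Filter.atTop, ∀ y ∈ correct,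
          ∃ v Y, Msg.precommit y r v Y ∈ ((c k).node q).log := by
        refine (Filter.eventually_all_finite (Set.toFinite correct)).2 fun y hy => ?_
        obtain ⟨k, hk, hph⟩ := hprecommit y hy
        obtain ⟨v, Y, hv⟩ := ((U.inv hy k).precommit hph).1
        rw [hr k hk y hy] at hv
        exact (U.eventually_log_subset hy hq k).mono fun j hj => ⟨v, Y, hj hv⟩
      obtain ⟨k, hk⟩ := hany.exists
      exact hno (U.eventually_lt_round hq (AtLeast.of_forall_mem U.quorum_le hk))
    · exact hno (Filter.Eventually.of_forall fun k q hq => absurd ⟨q, hq⟩ hne)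

end Undecided

end Liveness

/-! ### How a node leaves a phase -/

section Leaving

variable {Node Tx : Type*} {P : Params Node Tx} {p : Node} {t : ℝ} {s s' : NodeState Node Tx}

/-- The log contains two different proposals of round `r`. -/
def Conflict (P : Params Node Tx) (L : Set (Msg Node Tx)) (r : ℕ) : Prop :=
  ∃ v v' vr rr vr' rr', Proposed P L r v vr rr ∧ Proposed P L r v' vr' rr' ∧ v ≠ v'

theorem Conflict.mono {L L' : Set (Msg Node Tx)} (hL : L ⊆ L') {r : ℕ} (h : Conflict P L r) :
    Conflict P L' r := by
  obtain ⟨v, v', vr, rr, vr', rr', h1, h2, h3⟩ := h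
  exact ⟨v, v', vr, rr, vr', rr', hL h1, hL h2, h3⟩

theorem notMem_startRound {r r' : ℕ} {w : List Tx} {v : Option (List Tx)} {X : Set Tx} {y : Node}
    (h : Msg.precommit y r' v X ∉ s.log) :
    Msg.precommit y r' v X ∉ (startRound P p t r w s).log := by
  by_cases hp : P.proposer r = p
  · rw [startRound_log_of_eq P p t s r w hp]; simpa using h
  · rwa [startRound_log_of_ne P p t s r w hp]

variable [Fintype Node]

theorem Conflict.exists_handler (p : Node) (t : ℝ) (hphase : s.phase ≠ .precommit)
    (h : Conflict P s.log s.round) : ∃ s', Handler P p t s s' := by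
  obtain ⟨v, v', vr, rr, vr', rr', h1, h2, h3⟩ := h
  exact ⟨_, .conflict s v v' vr rr vr' rr' hphase h1 h2 h3⟩

/-- A node leaves the propose phase for a reason that is either visible in its log, and hence
spreads by gossip, or the expiry of its propose timer. -/
theorem Handler.leave_propose_cases (h : Handler P p t s s') (hph : s.phase = .propose)
    (hph' : s'.phase ≠ .propose) :
    (∃ v vr rr, Proposed P s.log s.round v vr rr ∧ Justified P s.log v vr rr ∧
      ∀ x, vr = some x → x < s.round) ∨
    Conflict P s.log s.round ∨ ∃ d, s.timerPropose = some d ∧ d ≤ t := by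
  have just : ∀ v rr, ((rr = none ∧ s.refRound = none) ∨
      ∃ r', rr = some r' ∧ VerifyReference P s.log r' v) → Justified P s.log v none rr :=
    fun v rr h => Or.inl ⟨rfl, h.imp_left And.left⟩
  cases h with
  | prevoteNew v rr D _ hprop href =>
    exact Or.inl ⟨v, none, rr, hprop, just v rr href, by simp⟩
  | rejectNew v rr _ hprop href =>
    exact Or.inl ⟨v, none, rr, hprop, just v rr href, by simp⟩
  | rejectUnreferenced v _ hprop =>
    exact Or.inl ⟨v, none, none, hprop, Or.inl ⟨rfl, Or.inl rfl⟩, by simp⟩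
  | prevoteOld v vr rr _ hprop hvr hqc hend =>
    exact Or.inl ⟨v, _, _, hprop, Or.inr ⟨vr, rr, rfl, rfl, hqc, hend⟩, by simpa using hvr⟩
  | rejectOld v vr rr _ hprop hvr hqc hend =>
    exact Or.inl ⟨v, _, _, hprop, Or.inr ⟨vr, rr, rfl, rfl, hqc, hend⟩, by simpa using hvr⟩
  | conflict v v' vr rr vr' rr' _ h1 h2 h3 =>
    exact Or.inr (Or.inl ⟨v, v', vr, rr, vr', rr', h1, h2, h3⟩)
  | timeoutPropose d htimer hd => exact Or.inr (Or.inr ⟨d, htimer, hd⟩)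
  | updateRef s₁ _ r v w rr hprop hex hrem hnovalid hshort hw h₁ h₂ =>
    subst h₁
    rcases h₂ with ⟨rfl, rfl⟩ | ⟨h₂, rfl⟩
    · simp at hph'
    · exact absurd hph hph'
  | skip | timeoutPrecommit => simp at hph'
  | _ => simp_all

/-- A node comes to the precommit phase for a reason that is either visible in its log, and hence
spreads by gossip, or the expiry of its prevote timer. -/
theorem Handler.enter_precommit_cases (h : Handler P p t s s') (hph : s.phase ≠ .precommit)
    (hph' : s'.phase = .precommit) :
    Lockable P s ∨ PrevotesFor P s.log s.round none ∨ Conflict P s.log s.round ∨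
    (∃ v rr, Proposed P s.log s.round v none rr ∧ PrevotesFor P s.log s.round (some v) ∧
      P.valid v ∧ ∀ tx ∈ v, TxEndorsed P s.log s.round v tx ∨ Vetoed P s.log s.round v tx) ∨
    ∃ d, s.timerPrevote = some d ∧ d ≤ t := by
  cases h with
  | lock v rr _ hcert => exact Or.inl ⟨v, rr, hcert⟩
  | precommitNil _ hnil => exact Or.inr (Or.inl hnil)
  | conflict v v' vr rr vr' rr' _ h1 h2 h3 =>
    exact Or.inr (Or.inr (Or.inl ⟨v, v', vr, rr, vr', rr', h1, h2, h3⟩))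
  | rapidRemoval v rr _ hprop hqc hvalid hall =>
    exact Or.inr (Or.inr (Or.inr (Or.inl ⟨v, rr, hprop, hqc, hvalid, hall⟩)))
  | timeoutPrevote d v rr htimer hd => exact Or.inr (Or.inr (Or.inr (Or.inr ⟨d, htimer, hd⟩)))
  | timeoutPrevoteNil d htimer hd => exact Or.inr (Or.inr (Or.inr (Or.inr ⟨d, htimer, hd⟩)))
  | updateRef s₁ _ r v w rr hprop hex hrem hnovalid hshort hw h₁ h₂ =>
    subst h₁
    rcases h₂ with ⟨rfl, rfl⟩ | ⟨h₂, rfl⟩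
    · simp at hph'
    · exact absurd hph' hph
  | skip | timeoutPrecommit => simp at hph'
  | _ => simp_all [NodeState.addMsg, castPrevote]

theorem Act.new_precommit (h : Act P p t s s') {y : Node} {r : ℕ} {v : Option (List Tx)}
    {X : Set Tx} (hm : Msg.precommit y r v X ∉ s.log) (hm' : Msg.precommit y r v X ∈ s'.log) :
    s'.round = r ∧ s'.phase = .precommit := by
  cases h with
  | start w hs ht hw heq =>
    subst heq
    exact absurd hm' (notMem_startRound (s := { s with started := True }) hm)
  | handle hs hd h =>
    cases h with
    | updateRef s₁ _ r v w rr hprop hex hrem hnovalid hshort hw h₁ h₂ =>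
      subst h₁
      rcases h₂ with ⟨rfl, rfl⟩ | ⟨h₂, rfl⟩
      · exact absurd hm' (notMem_startRound hm)
      · exact absurd hm' hm
    | skip | timeoutPrecommit => exact absurd hm' (notMem_startRound hm)
    | lock | precommitNil | conflict | rapidRemoval | timeoutPrevote | timeoutPrevoteNil =>
      rcases hm' with hm' | hm'
      · cases hm'; exact ⟨rfl, rfl⟩
      · exact absurd hm' hm
    | _ => simp_all [NodeState.addMsg, castPrevote]

end Leaving

/-! ### Synchronised rounds -/

/-- The first index at which some correct node has come to round `r` or beyond. -/
noncomputable def entry {Node Tx : Type*} (correct : Set Node) (c : ℕ → Config Node Tx)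
    (r : ℕ) : ℕ :=
  sInf {k | ∃ q ∈ correct, r ≤ ((c k).node q).round}

/-- The time at which the first correct node comes to round `r` or beyond. -/
noncomputable def entryTime {Node Tx : Type*} (correct : Set Node) (c : ℕ → Config Node Tx)
    (r : ℕ) : ℝ :=
  (c (entry correct c r)).now

theorem entry_le {Node Tx : Type*} {correct : Set Node} {c : ℕ → Config Node Tx} {q : Node}
    {k r : ℕ} (hq : q ∈ correct) (h : r ≤ ((c k).node q).round) : entry correct c r ≤ k :=
  Nat.sInf_le ⟨q, hq, h⟩

/-- From index `K` on, communication is synchronous, all correct nodes have started, and their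
references do not change. From round `R` on, which no correct node reaches before index `K`, the
timers are long. -/
structure Synchronous {Node Tx : Type*} [Fintype Node] (P : Params Node Tx) (correct : Set Node)
    (GST Δ : ℝ) (c : ℕ → Config Node Tx) (K R : ℕ) : Prop extends
    Undecided P correct GST Δ c where
  gst : ∀ k, K ≤ k → GST ≤ (c k).now
  started : ∀ k, K ≤ k → ∀ p ∈ correct, ((c k).node p).started
  refValue : ∀ k, K ≤ k → ∀ p ∈ correct, ((c k).node p).refValue = ((c K).node p).refValue
  late : ∀ k, ∀ p ∈ correct, R ≤ ((c k).node p).round → K ≤ k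
  timeoutPropose : ∀ r, R ≤ r → 2 * Δ ≤ P.timeoutPropose r
  timeoutPrevote : ∀ r, R ≤ r → 2 * Δ ≤ P.timeoutPrevote r
  timeoutPrecommit : ∀ r, R ≤ r → 2 * Δ ≤ P.timeoutPrecommit r

section Synchronous

variable {Node Tx : Type*} [Fintype Node] {P : Params Node Tx} {correct : Set Node} {GST Δ : ℝ}
  {c : ℕ → Config Node Tx} {p q x : Node} {i j k r : ℕ} {X d : ℝ} {K R : ℕ}

/-- A reference is only ever replaced by a shorter one, and hence eventually constant. -/
theorem Setting.eventually_refValue (H : Setting P correct GST Δ c) (p : Node) :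
    ∃ K, ∀ k, K ≤ k → ((c k).node p).refValue = ((c K).node p).refValue := by
  classical
  have step : ∀ k, ((c (k + 1)).node p).refValue = ((c k).node p).refValue ∨
      ∃ v, ((c (k + 1)).node p).refValue = some v ∧
        ∀ u, ((c k).node p).refValue = some u → v.length < u.length := by
    intro k
    rcases H.step_cases p k with h | ⟨m, h, -⟩ | ⟨h, -⟩
    · rw [h]; exact Or.inl rfl
    · rw [h]; exact Or.inl rfl
    · cases h with
      | start w hs ht hw heq => rw [heq]; exact Or.inl (by simp)
      | handle hs hd h => exact h.refValue_cases
  by_cases hex : ∃ n k u, ((c k).node p).refValue = some u ∧ u.length = n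
  · obtain ⟨K, u, hu, hn⟩ := Nat.find_spec hex
    refine ⟨K, fun k hk => ?_⟩
    induction k, hk using Nat.le_induction with
    | base => rfl
    | succ k _ ih =>
      rcases step k with h | ⟨v, hv, hlt⟩
      · rw [h, ih]
      · exact absurd ⟨k + 1, v, hv, rfl⟩ (Nat.find_min hex (hn ▸ hlt u (ih.trans hu)))
  · push Not at hex
    have hnone : ∀ k, ((c k).node p).refValue = none := fun k =>
      Option.eq_none_iff_forall_ne_some.2 fun u hu => hex _ k u hu rfl
    exact ⟨0, fun k _ => by rw [hnone, hnone]⟩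

theorem Undecided.exists_synchronous (U : Undecided P correct GST Δ c) (K₀ : ℕ) :
    ∃ K R, K₀ ≤ K ∧ Synchronous P correct GST Δ c K R := by
  have href : ∀ᶠ K in Filter.atTop, ∀ p ∈ correct, ∀ k, K ≤ k →
      ((c k).node p).refValue = ((c K).node p).refValue := by
    refine (Filter.eventually_all_finite (Set.toFinite correct)).2 fun p hp => ?_
    obtain ⟨K, hK⟩ := U.eventually_refValue p
    filter_upwards [Filter.eventually_ge_atTop K] with m hm k hk
    rw [hK k (hm.trans hk), hK m hm]
  obtain ⟨K₁, hK₁⟩ := Filter.eventually_atTop.1 (U.eventually_started.and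
    (U.exec.time.eventually (Filter.eventually_ge_atTop GST)))
  obtain ⟨K₂, hK₂⟩ := Filter.eventually_atTop.1 href
  obtain ⟨R, hR⟩ := U.timeout
  set K := max K₀ (max K₁ K₂) with hKdef
  have hK0 : K₀ ≤ K := le_max_left _ _
  have hK1 : K₁ ≤ K := (le_max_left _ _).trans (le_max_right _ _)
  have hK2 : K₂ ≤ K := (le_max_right _ _).trans (le_max_right _ _)
  set M := Finset.univ.sup fun p => ((c K).node p).round with hM
  refine ⟨K, max R (M + 1), hK0, U, fun k hk => (hK₁ k (hK1.trans hk)).2,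
    fun k hk => (hK₁ k (hK1.trans hk)).1, fun k hk p hp => hK₂ K hK2 p hp k hk,
    fun k p hp hr => ?_, fun r hr => (hR r ((le_max_left _ _).trans hr)).1,
    fun r hr => (hR r ((le_max_left _ _).trans hr)).2.1,
    fun r hr => (hR r ((le_max_left _ _).trans hr)).2.2⟩
  by_contra hlt
  have h1 := U.round_mono hp (not_le.1 hlt).le
  have h2 : ((c K).node p).round ≤ M :=
    Finset.le_sup (f := fun p => ((c K).node p).round) (Finset.mem_univ p)
  have h3 := (le_max_right R (M + 1)).trans hr
  omega

theorem Setting.entryTime_le (H : Setting P correct GST Δ c) (hq : q ∈ correct)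
    (h : r ≤ ((c k).node q).round) : entryTime correct c r ≤ (c k).now :=
  H.now_mono (entry_le hq h)

theorem Undecided.entry_spec (U : Undecided P correct GST Δ c) (r : ℕ) :
    ∃ q ∈ correct, r ≤ ((c (entry correct c r)).node q).round := by
  have hne : AtLeast (P.f + 1) fun _ : Node => True :=
    ⟨Finset.univ, by have := U.card; rw [Finset.card_univ]; omega, fun _ _ => trivial⟩
  obtain ⟨y, hy, -⟩ := U.exists_correct hne
  obtain ⟨k, hk⟩ := (U.rounds_tendsto r).exists
  exact Nat.sInf_mem (s := {k | ∃ q ∈ correct, r ≤ ((c k).node q).round}) ⟨k, y, hy, hk y hy⟩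

theorem Undecided.entryTime_mono (U : Undecided P correct GST Δ c) {r' : ℕ} (h : r ≤ r') :
    entryTime correct c r ≤ entryTime correct c r' := by
  obtain ⟨q, hq, hr⟩ := U.entry_spec r'
  exact U.entryTime_le hq (h.trans hr)

namespace Synchronous

theorem log_subset (S : Synchronous P correct GST Δ c K R) (hj : Cut c X j) (hp : p ∈ correct)
    (hq : q ∈ correct) (hk : K ≤ k) (hX : (c k).now + Δ ≤ X) :
    ((c k).node p).log ⊆ ((c j).node q).log :=
  S.log_subset_of_cut hj hp hq (by rwa [max_eq_left (S.gst k hk)])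

/-- The first correct node in round `r + 1` comes there when its precommit timer expires. -/
theorem exists_first_precommits (S : Synchronous P correct GST Δ c K R) (hr : R ≤ r) :
    ∃ i, ∃ q ∈ correct, ((c i).node q).round = r ∧ AnyPrecommits P ((c i).node q).log r ∧
      (c i).now + P.timeoutPrecommit r ≤ entryTime correct c (r + 1) := by
  obtain ⟨q, hq, hle⟩ := S.entry_spec (r + 1)
  obtain ⟨i, hi, hr1, hr2, hnow, hadv⟩ := S.exists_advance hq (Nat.succ_pos r) hle
  have hentry : entry correct c (r + 1) = i + 1 := le_antisymm (entry_le hq hr2) hi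
  have htime : entryTime correct c (r + 1) = (c i).now := by
    unfold entryTime; rw [hentry, hnow]
  rw [htime]
  cases hadv with
  | timeout d w htimer hd hw heq =>
    rw [heq, startRound_round] at hr2
    have hri : ((c i).node q).round = r := by omega
    obtain ⟨i', hi', hr', hany, hd'⟩ := S.timerPrecommit_origin hq htimer
    rw [hri] at hany hr' hd'
    exact ⟨i', q, hq, hr', hany, hd' ▸ hd⟩
  | reference v w rr hprop hex' hrem hnovalid hshort hw heq =>
    -- references no longer change
    exfalso
    have hri : ((c i).node q).round = r := by
      rw [heq, startRound_round] at hr2; omega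
    have hK := S.late i q hq (hri ▸ hr)
    have h1 : ((c (i + 1)).node q).refValue = some v := by rw [heq, startRound_refValue]
    rw [S.refValue (i + 1) (hK.trans (Nat.le_succ i)) q hq, ← S.refValue i hK q hq] at h1
    exact lt_irrefl _ (hshort v h1)
  | skip r' w hr' hmsgs hw heq =>
    exfalso
    rw [heq, startRound_round] at hr2
    obtain ⟨y, hy, m, hm, rfl, hmr⟩ := S.exists_correct hmsgs
    have h1 := ((S.inv hy i).own m (S.auth hq hm hy) rfl).2
    have : entry correct c (r + 1) ≤ i := entry_le hy (hr2.trans (hmr ▸ h1))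
    omega

theorem entryTime_succ (S : Synchronous P correct GST Δ c K R) (hr : R ≤ r) :
    entryTime correct c r + 2 * Δ ≤ entryTime correct c (r + 1) := by
  obtain ⟨i, q, hq, hri, -, hle⟩ := S.exists_first_precommits hr
  have := S.entryTime_le hq hri.ge
  have := S.timeoutPrecommit r hr
  linarith

theorem le_entry (S : Synchronous P correct GST Δ c K R) (hr : R ≤ r) :
    K ≤ entry correct c r := by
  obtain ⟨q, hq, hle⟩ := S.entry_spec r
  exact S.late _ q hq (hr.trans hle)

/-- All correct nodes come to round `r` within `Δ` after the first one. -/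
theorem le_round (S : Synchronous P correct GST Δ c K R) (hr : R < r) (hq : q ∈ correct)
    (hj : Cut c X j) (hX : entryTime correct c r + Δ ≤ X) : r ≤ ((c j).node q).round := by
  obtain ⟨r, rfl⟩ : ∃ r', r = r' + 1 := ⟨r - 1, by omega⟩
  have hr : R ≤ r := by omega
  obtain ⟨i, x, hx, hri, hany, hle⟩ := S.exists_first_precommits hr
  have hΔ := S.delta_pos
  have hT := S.timeoutPrecommit r hr
  have hKi := S.late i x hx (hri ▸ hr)
  obtain ⟨j₀, hij, hcut⟩ := S.exists_cut (k := i) (X := (c i).now + Δ) (by linarith)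
  have hs := S.started j₀ (hKi.trans hij) q hq
  -- at the cut `j₀`, `q` has the quorum of precommits and has started its precommit timer
  have hany' := hany.mono (S.log_subset hcut hx hq hKi le_rfl)
  have hge := S.le_round_of_anyPrecommits hcut hq hs hany'
  have hlt := hcut.lt
  have hjj : j₀ ≤ j := S.le_cut hj (by linarith)
  by_contra hno
  have h1 := S.round_mono hq hjj
  have hr0 : ((c j₀).node q).round = r := by omega
  obtain ⟨d, hd⟩ := S.exists_timerPrecommit hcut hq hs (by rw [hr0]; exact hany')
  obtain ⟨i', hi', -, -, hd'⟩ := S.timerPrecommit_origin hq hd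
  rw [hr0] at hd'
  have hsame := S.sameRound hq hjj hs (by omega)
  have hXd := S.le_timerPrecommit hj hq (S.started j ((hKi.trans hij).trans hjj) q hq)
    (hsame.timerPrecommit d hd)
  have h2 : (c i').now ≤ (c j₀).now := S.now_mono hi'.le
  linarith

theorem now_lt_of_round_lt (S : Synchronous P correct GST Δ c K R) (hr : R < r)
    (hq : q ∈ correct) (h : ((c k).node q).round < r) :
    (c k).now < entryTime correct c r + Δ := by
  obtain ⟨j, -, hj⟩ := S.exists_cut (k := entry correct c r)
    (X := entryTime correct c r + Δ) (lt_add_of_pos_right _ S.delta_pos)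
  have h1 := S.le_round hr hq hj le_rfl
  have h2 : k ≤ j := by
    by_contra hlt
    have := S.round_mono hq (not_le.1 hlt).le
    omega
  exact lt_of_le_of_lt (S.now_mono h2) hj.lt

/-- All correct nodes leave the propose phase of a round within `Δ` after the first one. -/
theorem phase_ne_propose (S : Synchronous P correct GST Δ c K R) (hr : R < r)
    (hx : x ∈ correct) (hri : ((c i).node x).round = r) (hph : ((c i).node x).phase ≠ .propose)
    (hj : Cut c X j) (hX : (c i).now + Δ ≤ X) (hq : q ∈ correct)
    (hrj : ((c j).node q).round = r) : ((c j).node q).phase ≠ .propose := by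
  intro hphq
  have hΔ := S.delta_pos
  obtain ⟨i₀, hi₀, hr0, hph0, hph1, hs0, h⟩ := S.exists_leave_propose hx hph
  rw [hri] at hr0
  have hK0 := S.late i₀ x hx (by omega)
  have hsj := S.started j (S.late j q hq (by omega)) q hq
  have hnow : (c i₀).now ≤ (c i).now := S.now_mono hi₀.le
  have hL := S.log_subset hj hx hq hK0 (by linarith)
  rcases h.leave_propose_cases hph0 hph1 with ⟨v, vr, rr, h1, h2, h3⟩ | h | ⟨d, hd, hdt⟩
  · rw [hr0] at h1 h3
    exact S.not_handler hj hq hsj le_rfl hj.lt (exists_handler_of_justified q _ hphq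
      (by rw [hrj]; exact hL h1) (h2.mono hL) (by rw [hrj]; exact h3))
  · rw [hr0] at h
    exact S.not_handler hj hq hsj le_rfl hj.lt (Conflict.exists_handler q _ (by simp [hphq])
      (by rw [hrj]; exact h.mono hL))
  · -- the propose timers of `x` and `q` were started less than `Δ` apart
    by_cases hpr : P.proposer r = q
    · exact S.proposer_phase_ne hj hq hsj (by rw [hrj, hpr]) hphq
    · obtain ⟨d', hd'⟩ := (S.inv hq j).timerPropose hsj (by rwa [hrj])
      have hXd := S.le_timerPropose hj hq hsj hphq hd'
      obtain ⟨e, he, he1, he2, hen, hde⟩ := S.timerPropose_origin hx (by omega) hd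
      obtain ⟨e', he', he1', he2', -, hde'⟩ := S.timerPropose_origin hq (by omega) hd'
      rw [hr0] at he2 hde
      rw [hrj] at he1' hde'
      have h1 := S.now_lt_of_round_lt hr hq he1'
      have h2 := S.entryTime_le hx he2.ge
      linarith

/-- All correct nodes leave the prevote phase of a round within `Δ` after the first one. -/
theorem phase_eq_precommit (S : Synchronous P correct GST Δ c K R) (hr : R < r)
    (hx : x ∈ correct) (hri : ((c i).node x).round = r)
    (hph : ((c i).node x).phase = .precommit) (hj : Cut c X j) (hX : (c i).now + Δ ≤ X)
    (hq : q ∈ correct) (hrj : ((c j).node q).round = r) :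
    ((c j).node q).phase = .precommit := by
  have hΔ := S.delta_pos
  have hne := S.phase_ne_propose hr hx hri (by simp [hph]) hj hX hq hrj
  by_contra hnp
  have hphq : ((c j).node q).phase = .prevote := by
    cases h : ((c j).node q).phase <;> simp_all
  obtain ⟨i₀, hi₀, hr0, hph0, hph1, h⟩ := S.exists_enter_precommit hx hph
  rw [hri] at hr0
  have hK0 := S.late i₀ x hx (by omega)
  have hsj := S.started j (S.late j q hq (by omega)) q hq
  have hnow : (c i₀).now ≤ (c i).now := S.now_mono hi₀.le
  have hL := S.log_subset hj hx hq hK0 (by linarith)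
  rcases h.enter_precommit_cases hph0 hph1 with ⟨v, rr, hcert⟩ | hnil | h |
    ⟨v, rr, hprop, hqc, hvalid, hall⟩ | ⟨d, hd, hdt⟩
  · rw [hr0] at hcert
    exact S.not_handler hj hq hsj le_rfl hj.lt
      ⟨_, .lock _ v rr hphq (by rw [hrj]; exact hcert.mono hL)⟩
  · rw [hr0] at hnil
    exact S.not_handler hj hq hsj le_rfl hj.lt
      ⟨_, .precommitNil _ hphq (by rw [hrj]; exact hnil.mono hL)⟩
  · rw [hr0] at h
    exact S.not_handler hj hq hsj le_rfl hj.lt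
      (Conflict.exists_handler q _ hnp (by rw [hrj]; exact h.mono hL))
  · rw [hr0] at hprop hqc hall
    refine S.not_handler hj hq hsj le_rfl hj.lt (exists_handler_of_rapidRemoval q _ hphq
      (v := v) (rr := rr) (by rw [hrj]; exact hL hprop) (by rw [hrj]; exact hqc.mono hL)
      hvalid ?_)
    rw [hrj]
    exact fun tx htx => (hall tx htx).imp (fun h => h.mono hL) fun h => h.mono hL
  · -- the prevote timers of `x` and `q` were started at most `Δ` apart
    obtain ⟨i₁, hi₁, hr1, hph1, hany, hdi⟩ := S.timerPrevote_origin hx hd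
    rw [hr0] at hr1 hany hdi
    have hT := S.timeoutPrevote r hr.le
    have hK1 := S.late i₁ x hx (by omega)
    obtain ⟨j₁, hij, hcut⟩ := S.exists_cut (k := i₁) (X := (c i₁).now + Δ) (by linarith)
    have hlt := hcut.lt
    have hjj : j₁ ≤ j := S.le_cut hj (by linarith)
    have hsj1 := S.started j₁ (hK1.trans hij) q hq
    have hrj1 : ((c j₁).node q).round = r := by
      refine le_antisymm (hrj ▸ S.round_mono hq hjj) (S.le_round hr hq hcut ?_)
      have := S.entryTime_le hx hr1.ge
      linarith
    have hsame := S.sameRound hq hjj hsj1 (by omega)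
    have hphj1 : ((c j₁).node q).phase = .prevote := by
      have h1 := S.phase_ne_propose hr hx hr1 (by simp [hph1]) hcut le_rfl hq hrj1
      have h2 := mt hsame.precommit hnp
      cases h : ((c j₁).node q).phase <;> simp_all
    obtain ⟨d', hd'⟩ := S.exists_timerPrevote hcut hq hsj1 hphj1 (by
      rw [hrj1]; exact hany.mono (S.log_subset hcut hx hq hK1 le_rfl))
    obtain ⟨i₂, hi₂, -, -, -, hdi'⟩ := S.timerPrevote_origin hq hd'
    rw [hrj1] at hdi'
    have hXd := S.le_timerPrevote hj hq hsj hphq (hsame.timerPrevote d' hd')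
    have h2 : (c i₂).now ≤ (c j₁).now := S.now_mono hi₂.le
    linarith

/-- Some correct node precommits in round `r` at least `2 * Δ` before round `r + 1` begins. -/
theorem exists_precommitted (S : Synchronous P correct GST Δ c K R) (hr : R ≤ r) :
    ∃ i, ∃ y ∈ correct, ((c i).node y).round = r ∧ ((c i).node y).phase = .precommit ∧
      (c i).now + 2 * Δ ≤ entryTime correct c (r + 1) := by
  obtain ⟨i, q, hq, hri, hany, hle⟩ := S.exists_first_precommits hr
  obtain ⟨y, hy, v, Y, hm⟩ := S.exists_correct_of_quorum hany
  obtain ⟨i', hi', h1, h2, hact⟩ := S.exists_act_of_mem (m := .precommit y r v Y) hy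
    (S.auth hq hm hy)
  obtain ⟨h3, h4⟩ := hact.new_precommit h1 h2
  refine ⟨i' + 1, y, hy, h3, h4, ?_⟩
  have h5 : (c (i' + 1)).now ≤ (c i).now := S.now_mono hi'
  have := S.timeoutPrecommit r hr
  linarith

/-- All correct nodes precommit in round `r`, more than `Δ` before round `r + 1` begins. -/
theorem exists_all_precommitted (S : Synchronous P correct GST Δ c K R) (hr : R < r) :
    ∃ j, (c j).now + Δ < entryTime correct c (r + 1) ∧ ∀ q ∈ correct,
      ((c j).node q).round = r ∧ ((c j).node q).phase = .precommit := by
  obtain ⟨i, y, hy, hri, hph, hle⟩ := S.exists_precommitted hr.le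
  have hΔ := S.delta_pos
  obtain ⟨j, -, hj⟩ := S.exists_cut (k := i) (X := (c i).now + Δ) (by linarith)
  have hlt := hj.lt
  refine ⟨j, by linarith, fun q hq => ?_⟩
  have hrj : ((c j).node q).round = r := by
    refine le_antisymm (not_lt.1 fun h => ?_) (S.le_round hr hq hj ?_)
    · have := S.entryTime_le hq (Nat.succ_le_of_lt h)
      linarith
    · have := S.entryTime_le hy hri.ge
      linarith
  exact ⟨hrj, S.phase_eq_precommit hr hy hri hph hj le_rfl hq hrj⟩

/-- When round `r` begins, every correct node knows of the locks of all earlier rounds. -/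
theorem exists_le_validRound (S : Synchronous P correct GST Δ c K R) (hr : R + 1 < r)
    (hq : q ∈ correct) (hp : p ∈ correct) {l k' : ℕ}
    (hl : ((c k).node q).lockedRound = some l) (hlr : l < r)
    (hk' : entryTime correct c r ≤ (c k').now) :
    ∃ y, l ≤ y ∧ ((c k').node p).validRound = some y := by
  have hΔ := S.delta_pos
  obtain ⟨i, -, hri, hph, v, rr, hcert⟩ := S.lockedRound_origin hq hl
  have h1 := S.entryTime_succ (le_refl R)
  have h2 := S.entryTime_succ (Nat.le_succ R)
  have h3 := S.entryTime_mono (show R + 1 + 1 ≤ r by omega)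
  have hi : (c i).now + Δ ≤ entryTime correct c r := by
    by_cases hRl : R < l
    · obtain ⟨j, hj, hall⟩ := S.exists_all_precommitted hRl
      have hij : i ≤ j := by
        by_contra hlt
        have hsame := S.sameRound hq (not_le.1 hlt).le
          (S.started j (S.late j q hq (by rw [(hall q hq).1]; exact hRl.le)) q hq)
          (by rw [hri, (hall q hq).1])
        have := hsame.precommit (hall q hq).2
        simp [hph] at this
      have h4 : (c i).now ≤ (c j).now := S.now_mono hij
      have h5 := S.entryTime_mono (show l + 1 ≤ r by omega)
      linarith
    · have h4 := S.now_lt_of_round_lt (Nat.lt_succ_self R) hq (k := i) (by omega)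
      simp only [Nat.succ_eq_add_one] at h4
      linarith
  have hgst : GST ≤ entryTime correct c R := S.gst _ (S.le_entry le_rfl)
  obtain ⟨j, -, hj⟩ := S.exists_cut (k := i) (X := entryTime correct c r) (by linarith)
  have hKj : K ≤ j := (S.le_entry le_rfl).trans
    (S.le_cut hj (k := entry correct c R) (by unfold entryTime at *; linarith))
  have hL : ((c i).node q).log ⊆ ((c j).node p).log := by
    refine S.log_subset_of_cut hj hq hp ?_
    rcases max_cases (c i).now GST with ⟨h, -⟩ | ⟨h, -⟩ <;> rw [h] <;> linarith
  -- otherwise `p` would update its valid value at the cut `j`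
  by_contra! hno
  refine S.not_handler hj hp (S.started j hKj p hp) le_rfl hj.lt
    (exists_handler_of_certified p _ (hcert.mono hL) fun r' hr' => ?_)
  by_contra hle
  obtain ⟨y, hy, hy'⟩ := S.validRound_mono p (S.cut_lt hj hk').le hr'
  exact hno y ((not_lt.1 hle).trans hy) hy'

end Synchronous

end Synchronous

/-! ### Rounds with a correct proposer -/

section Votes

variable {Node Tx : Type*} {P : Params Node Tx} {p : Node} {t : ℝ} {s s' : NodeState Node Tx}

theorem prevote_notMem_startRound {r r' : ℕ} {w : List Tx} {v : Option (List Tx)} {b : Bool}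
    {D : Option (Set Tx)} {y : Node} (h : Msg.prevote y r' v b D ∉ s.log) :
    Msg.prevote y r' v b D ∉ (startRound P p t r w s).log := by
  by_cases hp : P.proposer r = p
  · rw [startRound_log_of_eq P p t s r w hp]; simpa using h
  · rwa [startRound_log_of_ne P p t s r w hp]

variable [Fintype Node]

theorem Act.new_prevote (h : Act P p t s s') {y : Node} {r : ℕ} {v : Option (List Tx)}
    {D : Option (Set Tx)} (hm : Msg.prevote y r v true D ∉ s.log)
    (hm' : Msg.prevote y r v true D ∈ s'.log) :
    s.round = r ∧ s.phase = .propose ∧ s'.phase ≠ .propose ∧ Handler P p t s s' ∧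
      ∀ u, v = some u → P.valid u := by
  cases h with
  | start w hs ht hw heq =>
    subst heq
    exact absurd hm' (prevote_notMem_startRound (s := { s with started := True }) hm)
  | handle hs hd h =>
    have h0 := h
    cases h with
    | updateRef s₁ _ r v w rr hprop hex hrem hnovalid hshort hw h₁ h₂ =>
      subst h₁
      rcases h₂ with ⟨rfl, rfl⟩ | ⟨h₂, rfl⟩
      · exact absurd hm' (prevote_notMem_startRound
          (s := { s with refRound := some s.round, refValue := some v }) hm)
      · exact absurd hm' hm
    | skip | timeoutPrecommit => exact absurd hm' (prevote_notMem_startRound hm)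
    | prevoteNew v rr D hphase hprop href hvalid | prevoteOld v _ _ hphase _ _ _ _ hvalid =>
      rcases hm' with hm' | hm'
      · cases hm'
        exact ⟨rfl, hphase, by simp [castPrevote], h0, by simpa using hvalid⟩
      · exact absurd hm' hm
    | rejectNew _ _ hphase | rejectUnreferenced _ hphase | rejectOld _ _ _ hphase
    | timeoutPropose _ _ _ hphase =>
      rcases hm' with hm' | hm'
      · cases hm'
        exact ⟨rfl, hphase, by simp [castPrevote], h0, by simp⟩
      · exact absurd hm' hm
    | _ => simp_all [NodeState.addMsg, castPrecommit]

theorem Act.new_proposal (h : Act P p t s s') {y : Node} {r : ℕ} {v : List Tx}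
    {vr rr : Option ℕ} (hm : Msg.proposal y r v vr rr ∉ s.log)
    (hm' : Msg.proposal y r v vr rr ∈ s'.log) : s'.round = 0 ∨ s.round < s'.round := by
  cases h with
  | start w hs ht hw heq => subst heq; simp
  | handle hs hd h =>
    rcases h.advance_or_round_eq with ha | -
    · exact Or.inr ha.round_lt
    · cases h with
      | updateRef s₁ _ r v w rr hprop hex hrem hnovalid hshort hw h₁ h₂ =>
        subst h₁
        rcases h₂ with ⟨rfl, rfl⟩ | ⟨h₂, rfl⟩
        · simp
        · exact absurd hm' hm
      | skip r w hr => simpa using Or.inr hr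
      | timeoutPrecommit => simp
      | _ => simp_all [NodeState.addMsg, castPrecommit, castPrevote]

/-- A correct node precommits a value only if it checked its validity or relies on a quorum that
did. -/
theorem Act.precommit_origin (h : Act P p t s s') {y : Node} {r : ℕ} {v : List Tx}
    {X : Set Tx} (hm : Msg.precommit y r (some v) X ∉ s.log)
    (hm' : Msg.precommit y r (some v) X ∈ s'.log) :
    P.valid v ∨ PrevotesFor P s.log r (some v) := by
  cases h with
  | start w hs ht hw heq =>
    subst heq
    exact absurd hm' (notMem_startRound (s := { s with started := True }) hm)
  | handle hs hd h =>
    cases h with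
    | updateRef s₁ _ r v w rr hprop hex hrem hnovalid hshort hw h₁ h₂ =>
      subst h₁
      rcases h₂ with ⟨rfl, rfl⟩ | ⟨h₂, rfl⟩
      · exact absurd hm' (notMem_startRound
          (s := { s with refRound := some s.round, refValue := some v }) hm)
      · exact absurd hm' hm
    | skip | timeoutPrecommit => exact absurd hm' (notMem_startRound hm)
    | lock v rr _ hcert =>
      rcases hm' with hm' | hm'
      · cases hm'; exact Or.inl hcert.2.2.1
      · exact absurd hm' hm
    | rapidRemoval v rr _ _ _ hvalid =>
      rcases hm' with hm' | hm'
      · cases hm'; exact Or.inl hvalid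
      · exact absurd hm' hm
    | timeoutPrevote d v rr _ _ _ _ _ hqc =>
      rcases hm' with hm' | hm'
      · cases hm'; exact Or.inr hqc
      · exact absurd hm' hm
    | _ => simp_all [NodeState.addMsg, castPrecommit, castPrevote]

end Votes

section Validity

variable {Node Tx : Type*} [Fintype Node] {P : Params Node Tx} {correct : Set Node} {GST Δ : ℝ}
  {c : ℕ → Config Node Tx} {p : Node} {k r : ℕ}

theorem Setting.valid_of_prevotesFor (H : Setting P correct GST Δ c) (hp : p ∈ correct)
    {v : List Tx} (h : PrevotesFor P ((c k).node p).log r (some v)) : P.valid v := by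
  obtain ⟨y, hy, D, hm⟩ := H.exists_correct_of_quorum h
  obtain ⟨i, -, h1, h2, hact⟩ := H.exists_act_of_mem (m := .prevote y r (some v) true D) hy
    (H.auth hp hm hy)
  exact (hact.new_prevote h1 h2).2.2.2.2 v rfl

/-- An examined value is valid, since a correct node precommitted it. -/
theorem Setting.valid_of_precommitsFor (H : Setting P correct GST Δ c) (hp : p ∈ correct)
    {v : List Tx} (h : PrecommitsFor P ((c k).node p).log r v) : P.valid v := by
  obtain ⟨y, hy, X, hm⟩ := H.exists_correct_of_quorum h
  obtain ⟨i, -, h1, h2, hact⟩ := H.exists_act_of_mem (m := .precommit y r (some v) X) hy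
    (H.auth hp hm hy)
  rcases hact.precommit_origin h1 h2 with h | h
  · exact h
  · exact H.valid_of_prevotesFor hy h

theorem Setting.valid_proposalValue (H : Setting P correct GST Δ c) (hp : p ∈ correct)
    {w : List Tx} (hw : P.valid w) : P.valid (proposalValue P ((c k).node p) w) := by
  have hsound := (H.inv hp k).sound
  cases hx : ((c k).node p).validRound with
  | some x =>
    obtain ⟨v, rr, y, hv, hy, hc, he⟩ := hsound.of_some x hx
    unfold proposalValue
    rw [hv]
    exact hc.2.2.1
  | none =>
    obtain ⟨hv, ⟨h1, -⟩ | ⟨r, u, rr, h1, h2, -, hex, -⟩⟩ := hsound.of_none hx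
    · unfold proposalValue
      rw [hv, h1]
      exact hw
    · unfold proposalValue
      rw [hv, h1, h2]
      exact H.valid_sublist _ u (extract_sublist r u) (H.valid_of_precommitsFor hp hex)

end Validity

/-- Round `r` is late, and its correct proposer `p` enters it in the step from index `e`, where it
proposes `(v, vr, rr)`. -/
structure GoodRound {Node Tx : Type*} [Fintype Node] (P : Params Node Tx) (correct : Set Node)
    (GST Δ : ℝ) (c : ℕ → Config Node Tx) (K R : ℕ) (p : Node) (r e : ℕ) (v : List Tx)
    (vr rr : Option ℕ) : Prop extends Synchronous P correct GST Δ c K R where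
  mem : p ∈ correct
  proposer_eq : P.proposer r = p
  lt : R + 1 < r
  round_lt : ((c e).node p).round < r
  round_eq : ((c (e + 1)).node p).round = r
  now_eq : (c (e + 1)).now = (c e).now
  proposed : Proposed P ((c (e + 1)).node p).log r v vr rr
  justified : Justified P ((c e).node p).log v vr rr
  valid : P.valid v
  validRound : ((c e).node p).validRound = vr
  refRound : ((c e).node p).refRound = rr
  short : vr = none → ∀ u, ((c e).node p).refValue = some u → v.length < u.length

section GoodRounds

variable {Node Tx : Type*} [Fintype Node] {P : Params Node Tx} {correct : Set Node} {GST Δ : ℝ}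
  {c : ℕ → Config Node Tx} {p q : Node} {i j k r e : ℕ} {X d : ℝ} {K R : ℕ} {v : List Tx}
  {vr rr : Option ℕ}

theorem Synchronous.exists_goodRound (S : Synchronous P correct GST Δ c K R) (hp : p ∈ correct) :
    ∃ r e v vr rr, GoodRound P correct GST Δ c K R p r e v vr rr := by
  obtain ⟨r, hr, hpr⟩ := S.proposer p (R + 2)
  have hΔ := S.delta_pos
  obtain ⟨j, -, hj⟩ := S.exists_cut (k := entry correct c r)
    (X := entryTime correct c r + Δ) (lt_add_of_pos_right _ hΔ)
  have hge := S.le_round (show R < r by omega) hp hj le_rfl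
  have hlt := hj.lt
  have hle : ((c j).node p).round ≤ r := by
    by_contra hgt
    have h1 := S.entryTime_le hp (not_le.1 hgt)
    have h2 := S.entryTime_succ (show R ≤ r by omega)
    simp only [Nat.succ_eq_add_one] at h1
    linarith
  obtain ⟨e, he, h1, h2, h3, hadv⟩ := S.exists_advance hp (show 0 < r by omega) hge
  have h4 : ((c (e + 1)).node p).round = r :=
    le_antisymm ((S.round_mono hp he).trans hle) h2
  have hKe : K ≤ e := by
    have h5 := S.entryTime_le hp h2
    have h6 := S.entryTime_succ (le_refl R)
    have h7 := S.entryTime_mono (show R + 1 ≤ r by omega)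
    have h8 : entry correct c R ≤ e := by
      by_contra hlt
      have h9 : (c e).now ≤ entryTime correct c R := S.now_mono (not_le.1 hlt).le
      linarith
    exact (S.le_entry le_rfl).trans h8
  obtain ⟨w, hw, heq⟩ : ∃ w, P.valid w ∧
      (c (e + 1)).node p = startRound P p (c e).now r w ((c e).node p) := by
    cases hadv with
    | timeout d w htimer hd hw heq =>
      refine ⟨w, hw, ?_⟩
      rw [heq, startRound_round] at h4
      rw [heq, h4]
    | skip r' w hr' hmsgs hw heq =>
      refine ⟨w, hw, ?_⟩
      rw [heq, startRound_round] at h4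
      rw [heq, h4]
    | reference v w rr hprop hex' hrem hnovalid hshort hw heq =>
      exfalso
      have h5 : ((c (e + 1)).node p).refValue = some v := by rw [heq, startRound_refValue]
      rw [S.refValue (e + 1) (hKe.trans (Nat.le_succ e)) p hp, ← S.refValue e hKe p hp] at h5
      exact lt_irrefl _ (hshort v h5)
  refine ⟨r, e, proposalValue P ((c e).node p) w, _, _, S, hp, hpr, by omega, h1, h4, h3, ?_,
    (S.inv hp e).sound.justified w, S.valid_proposalValue hp hw, rfl, rfl, ?_⟩
  · unfold Proposed
    rw [heq, startRound_log_of_eq _ _ _ _ _ _ hpr, hpr]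
    exact Set.mem_insert _ _
  · intro hvr u hu
    obtain ⟨hv, ⟨-, h6⟩ | ⟨r', u', rr', h6, h7, -, -, hrem⟩⟩ := (S.inv hp e).sound.of_none hvr
    · simp [h6] at hu
    · obtain rfl : u' = u := by rw [h7] at hu; simpa using hu
      have : proposalValue P ((c e).node p) w = extract P ((c e).node p).log r' u' := by
        unfold proposalValue; rw [hv, h6, h7]
      rw [this]
      exact length_extract_lt hrem

namespace GoodRound

theorem entryTime_le_now (G : GoodRound P correct GST Δ c K R p r e v vr rr) :
    entryTime correct c r ≤ (c e).now := by
  rw [← G.now_eq]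
  exact G.entryTime_le G.mem G.round_eq.ge

theorem now_lt (G : GoodRound P correct GST Δ c K R p r e v vr rr) :
    (c e).now < entryTime correct c r + Δ :=
  G.now_lt_of_round_lt (by have := G.lt; omega) G.mem G.round_lt

theorem le_index (G : GoodRound P correct GST Δ c K R p r e v vr rr) : K ≤ e := by
  have h1 := G.lt
  have h2 := G.entryTime_succ (le_refl R)
  have h3 := G.entryTime_mono (show R + 1 ≤ r by omega)
  have h4 := G.entryTime_le_now
  have h5 := G.delta_pos
  refine (G.le_entry le_rfl).trans (not_lt.1 fun hlt => ?_)
  have h6 : (c e).now ≤ entryTime correct c R := G.now_mono hlt.le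
  linarith

/-- The proposal of the correct proposer is the only one of this round. -/
theorem eq_of_proposed (G : GoodRound P correct GST Δ c K R p r e v vr rr) (hq : q ∈ correct)
    {v' : List Tx} {vr' rr' : Option ℕ} (h : Proposed P ((c k).node q).log r v' vr' rr') :
    (v' = v ∧ vr' = vr ∧ rr' = rr) ∧ e < k := by
  have hpos : 0 < r := by have := G.lt; omega
  unfold Proposed at h
  rw [G.proposer_eq] at h
  obtain ⟨i, hi, h1, h2, hact⟩ := G.exists_act_of_mem (m := .proposal p r v' vr' rr') G.mem
    (G.auth hq h G.mem)
  simp only [Msg.src] at h1 h2 hact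
  rcases hact.log_cases with hl | ⟨m, hm, hmr, hl⟩
  · exact absurd (hl ▸ h2) h1
  obtain rfl : Msg.proposal p r v' vr' rr' = m := by
    rcases hl ▸ h2 with h | h
    · exact h
    · exact absurd h h1
  have hri : r = ((c (i + 1)).node p).round := hmr
  have hlt : ((c i).node p).round < r := by
    rcases hact.new_proposal h1 h2 with h0 | h0
    · omega
    · omega
  -- `p` sends proposals of round `r` only when it enters that round
  have hie : i = e := by
    have h3 := G.round_lt
    have h4 := G.round_eq
    rcases lt_trichotomy i e with h | h | h
    · have := G.round_mono G.mem (Nat.succ_le_of_lt h)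
      simp only [Nat.succ_eq_add_one] at this
      omega
    · exact h
    · have := G.round_mono G.mem (Nat.succ_le_of_lt h)
      simp only [Nat.succ_eq_add_one] at this
      omega
  subst hie
  refine ⟨?_, hi⟩
  have hprop := G.proposed
  unfold Proposed at hprop
  rw [G.proposer_eq, hl] at hprop
  rcases hprop with h | h
  · cases h
    exact ⟨rfl, rfl, rfl⟩
  · have := ((G.inv G.mem i).own _ h rfl).2
    exact absurd (lt_of_le_of_lt this G.round_lt) (lt_irrefl _)

theorem validRound_lt (G : GoodRound P correct GST Δ c K R p r e v vr rr) {x : ℕ}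
    (hx : vr = some x) : x < r := by
  have hlt := G.lt
  obtain ⟨u, rr', y, -, -, ⟨⟨vr', hprop⟩, hqc, -⟩, -⟩ :=
    (G.inv G.mem e).sound.of_some x (G.validRound.trans hx)
  rcases lt_trichotomy x r with h | h | h
  · exact h
  · exfalso
    subst h
    exact lt_irrefl _ (((G.inv G.mem e).own _ hprop G.proposer_eq).2.trans_lt G.round_lt)
  · -- a correct node would have prevoted in a later round already
    exfalso
    obtain ⟨z, hz, D, hm⟩ := G.exists_correct_of_quorum hqc
    have h1 := ((G.inv hz e).own _ (G.auth G.mem hm hz) rfl).2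
    have h2 := G.entryTime_le hz (show r + 1 ≤ _ from (Nat.succ_le_of_lt h).trans h1)
    have h3 := G.entryTime_succ (show R ≤ r by omega)
    have h4 := G.now_lt
    have h5 := G.delta_pos
    linarith

/-- While it is in the propose phase, no correct node holds a lock that prevents it from voting for
the proposal. -/
theorem le_of_lockedRound (G : GoodRound P correct GST Δ c K R p r e v vr rr)
    (hq : q ∈ correct) (hr : ((c i).node q).round = r) (hph : ((c i).node q).phase = .propose)
    {l : ℕ} (hl : ((c i).node q).lockedRound = some l) : ∃ y, l ≤ y ∧ vr = some y := by
  have hlt := G.lt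
  obtain ⟨i', hi', hr', hph', -⟩ := G.lockedRound_origin hq hl
  have hle : l ≤ r := by
    rw [← hr', ← hr]; exact G.round_mono hq hi'.le
  have hne : l ≠ r := by
    rintro rfl
    have := (G.sameRound hq hi'.le (G.started i' (G.late i' q hq (by omega)) q hq)
      (by omega)).propose hph
    simp [hph'] at this
  obtain ⟨y, hy, hy'⟩ := G.exists_le_validRound hlt hq G.mem hl (lt_of_le_of_ne hle hne)
    G.entryTime_le_now
  exact ⟨y, hy, by rw [← G.validRound, hy']⟩

/-- A correct node that leaves the propose phase in time does so by voting for the proposal. -/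
theorem leave_propose (G : GoodRound P correct GST Δ c K R p r e v vr rr)
    (href : vr = none → rr = none → ∀ k, K ≤ k → ∀ q ∈ correct, ((c k).node q).refRound = none)
    (hq : q ∈ correct) (hr : ((c i).node q).round = r) (hph : ((c i).node q).phase = .propose)
    (h : Handler P q (c i).now ((c i).node q) ((c (i + 1)).node q))
    (hph' : ((c (i + 1)).node q).phase ≠ .propose)
    (hnow : (c i).now < entryTime correct c r + 2 * Δ) :
    e < i ∧ ∃ D, (c (i + 1)).node q = castPrevote q (some v) D ((c i).node q) := by
  have hlt := G.lt
  generalize hs' : (c (i + 1)).node q = s' at h hph'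
  have hpr : ∀ {v' vr' rr'}, Proposed P ((c i).node q).log ((c i).node q).round v' vr' rr' →
      (v' = v ∧ vr' = vr ∧ rr' = rr) ∧ e < i := by
    intro v' vr' rr' h
    rw [hr] at h
    exact G.eq_of_proposed hq h
  cases h with
  | prevoteNew v' rr' D _ hprop =>
    obtain ⟨⟨rfl, -, -⟩, he⟩ := hpr hprop
    exact ⟨he, _, rfl⟩
  | rejectNew v' rr' _ hprop _ hbad =>
    obtain ⟨⟨rfl, hvr, -⟩, -⟩ := hpr hprop
    refine absurd ⟨G.valid, Or.inl ?_⟩ hbad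
    by_contra hne
    obtain ⟨l, hl⟩ := Option.ne_none_iff_exists'.1 hne
    obtain ⟨y, -, hy⟩ := G.le_of_lockedRound hq hr hph hl
    simp [← hvr] at hy
  | rejectUnreferenced v' _ hprop href' =>
    obtain ⟨⟨rfl, hvr, hrr⟩, -⟩ := hpr hprop
    exact absurd (href hvr.symm hrr.symm i (G.late i q hq (by omega)) q hq) href'
  | prevoteOld v' vr' rr' _ hprop =>
    obtain ⟨⟨rfl, -, -⟩, he⟩ := hpr hprop
    exact ⟨he, _, rfl⟩
  | rejectOld v' vr' rr' _ hprop _ _ _ hbad =>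
    obtain ⟨⟨rfl, hvr, -⟩, -⟩ := hpr hprop
    refine absurd ⟨G.valid, Or.inl fun l hl => ?_⟩ hbad
    obtain ⟨y, hy, hy'⟩ := G.le_of_lockedRound hq hr hph hl
    obtain rfl : vr' = y := by rw [← hvr] at hy'; simpa using hy'
    exact hy
  | conflict u u' _ _ _ _ _ h1 h2 h3 =>
    exact absurd ((hpr h1).1.1.trans (hpr h2).1.1.symm) h3
  | timeoutPropose d htimer hd =>
    exfalso
    obtain ⟨i', -, -, hr', hn, hd'⟩ := G.timerPropose_origin hq (by omega) htimer
    rw [hr] at hr' hd'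
    have h1 := G.entryTime_le hq hr'.ge
    have h2 := G.timeoutPropose r (by omega)
    linarith
  | updateRef s₁ _ r v w rr hprop hex hrem hnovalid hshort hw h₁ h₂ =>
    subst h₁
    rcases h₂ with ⟨-, rfl⟩ | ⟨h₂, rfl⟩
    · simp at hph'
    · exact absurd hph hph'
  | skip | timeoutPrecommit => simp at hph'
  | _ => simp_all

/-- Shortly after the proposal, all correct nodes have voted for it. -/
theorem exists_prevoted (G : GoodRound P correct GST Δ c K R p r e v vr rr)
    (href : vr = none → rr = none → ∀ k, K ≤ k → ∀ q ∈ correct, ((c k).node q).refRound = none) :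
    ∃ j, (c j).now < (c e).now + Δ ∧ ∀ q ∈ correct, ((c j).node q).round = r ∧
      ((c j).node q).phase ≠ .propose ∧
      ∃ D, Msg.prevote q r (some v) true D ∈ ((c j).node q).log := by
  have hΔ := G.delta_pos
  have hlt := G.lt
  have h1 := G.entryTime_le_now
  have h2 := G.now_lt
  have h3 := G.entryTime_succ (show R ≤ r by omega)
  obtain ⟨j, hej, hj⟩ := G.exists_cut (k := e) (X := (c e).now + Δ) (by linarith)
  have h4 := hj.lt
  refine ⟨j, h4, fun q hq => ?_⟩
  have hrj : ((c j).node q).round = r := by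
    refine le_antisymm (not_lt.1 fun h => ?_)
      (G.le_round (by omega) hq hj (by linarith))
    have := G.entryTime_le hq (Nat.succ_le_of_lt h)
    simp only [Nat.succ_eq_add_one] at this
    linarith
  have hs := G.started j (G.le_index.trans hej) q hq
  have hph : ((c j).node q).phase ≠ .propose := by
    intro hph
    have hL := G.log_subset hj G.mem hq (G.le_index.trans (Nat.le_succ e)) (by rw [G.now_eq])
    refine G.not_handler hj hq hs le_rfl hj.lt (exists_handler_of_justified q _ hph
      (by rw [hrj]; exact hL G.proposed)
      (G.justified.mono ((G.log_mono p (Nat.le_succ e)).trans hL)) fun x hx => ?_)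
    rw [hrj]
    exact G.validRound_lt hx
  refine ⟨hrj, hph, ?_⟩
  obtain ⟨i, hi, hr, hph0, hph1, -, h⟩ := G.exists_leave_propose hq hph
  rw [hrj] at hr
  have hnow : (c i).now ≤ (c j).now := G.now_mono hi.le
  obtain ⟨-, D, hcast⟩ := G.leave_propose href hq hr hph0 h hph1 (by linarith)
  refine ⟨D, G.log_mono q (Nat.succ_le_of_lt hi) ?_⟩
  rw [Nat.succ_eq_add_one, hcast, ← hr]
  exact Set.mem_insert _ _

/-- `2 * Δ` after the proposal, the proposed value is known to be quorum-certified. -/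
theorem prevotesFor (G : GoodRound P correct GST Δ c K R p r e v vr rr)
    (href : vr = none → rr = none → ∀ k, K ≤ k → ∀ q ∈ correct, ((c k).node q).refRound = none)
    (hq : q ∈ correct) (hk : (c e).now + 2 * Δ ≤ (c k).now) :
    PrevotesFor P ((c k).node q).log r (some v) := by
  obtain ⟨j, hj, hall⟩ := G.exists_prevoted href
  have hΔ := G.delta_pos
  have hlt := G.lt
  obtain ⟨j', -, hj'⟩ := G.exists_cut (k := j) (X := (c e).now + 2 * Δ) (by linarith)
  refine AtLeast.of_forall_mem G.quorum_le fun y hy => ?_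
  obtain ⟨hr, -, D, hD⟩ := hall y hy
  exact ⟨D, G.log_mono q (G.cut_lt hj' hk).le
    (G.log_subset hj' hy hq (G.late j y hy (by omega)) (by linarith) hD)⟩

theorem proposed_of_le (G : GoodRound P correct GST Δ c K R p r e v vr rr)
    (hq : q ∈ correct) (hk : (c e).now + 2 * Δ ≤ (c k).now) :
    Proposed P ((c k).node q).log r v vr rr := by
  have hΔ := G.delta_pos
  obtain ⟨j', -, hj'⟩ := G.exists_cut (k := e) (X := (c e).now + 2 * Δ) (by linarith)
  refine G.log_mono q (G.cut_lt hj' hk).le (G.log_subset hj' G.mem hq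
    (G.le_index.trans (Nat.le_succ e)) ?_ G.proposed)
  rw [G.now_eq]
  linarith

theorem not_prevotesFor_none (G : GoodRound P correct GST Δ c K R p r e v vr rr)
    (href : vr = none → rr = none → ∀ k, K ≤ k → ∀ q ∈ correct, ((c k).node q).refRound = none)
    (hq : q ∈ correct) : ¬ PrevotesFor P ((c k).node q).log r none := by
  intro h
  have hΔ := G.delta_pos
  have hlt := G.lt
  obtain ⟨y, hy, D, hm⟩ := G.exists_correct_of_quorum h
  obtain ⟨i, -, h1, h2, hact⟩ := G.exists_act_of_mem (m := .prevote y r none true D) hy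
    (G.auth hq hm hy)
  obtain ⟨hr, hph, hph', hh, -⟩ := hact.new_prevote h1 h2
  simp only [Msg.src] at h1 h2 hr hph hph' hh
  obtain ⟨j, hj, hall⟩ := G.exists_prevoted href
  obtain ⟨hrj, hphj, -⟩ := hall y hy
  have hij : i ≤ j := by
    by_contra hji
    exact hphj ((G.sameRound hy (not_le.1 hji).le
      (G.started j (G.late j y hy (by omega)) y hy) (by omega)).propose hph)
  have hnow : (c i).now ≤ (c j).now := G.now_mono hij
  have := G.now_lt
  obtain ⟨-, D', hcast⟩ := G.leave_propose href hy hr hph hh hph' (by linarith)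
  rw [hcast] at h2
  rcases h2 with h2 | h2
  · simp at h2
  · exact h1 h2

theorem now_le_of_phase_ne (G : GoodRound P correct GST Δ c K R p r e v vr rr)
    (href : vr = none → rr = none → ∀ k, K ≤ k → ∀ q ∈ correct, ((c k).node q).refRound = none)
    (hq : q ∈ correct) (hr : ((c k).node q).round = r)
    (hph : ((c k).node q).phase ≠ .propose) : (c e).now ≤ (c k).now := by
  obtain ⟨i, hi, hri, hph0, hph1, -, h⟩ := G.exists_leave_propose hq hph
  rw [hr] at hri
  have hik : (c i).now ≤ (c k).now := G.now_mono hi.le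
  refine le_trans ?_ hik
  by_cases hnow : (c i).now < entryTime correct c r + 2 * Δ
  · exact G.now_mono (G.leave_propose href hq hri hph0 h hph1 hnow).1.le
  · have h1 := G.now_lt
    have h2 := G.delta_pos
    linarith

/-- How a correct node comes to the precommit phase: it locks the proposed value, or it precommits
a new value with the removal of what is not endorsed, or else the value was not new and cannot be
locked although everything has arrived. -/
theorem enter_precommit (G : GoodRound P correct GST Δ c K R p r e v vr rr)
    (href : vr = none → rr = none → ∀ k, K ≤ k → ∀ q ∈ correct, ((c k).node q).refRound = none)
    (hq : q ∈ correct) (hr : ((c i).node q).round = r)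
    (hph : ((c i).node q).phase ≠ .precommit)
    (h : Handler P q (c i).now ((c i).node q) ((c (i + 1)).node q))
    (hph' : ((c (i + 1)).node q).phase = .precommit) :
    ((∃ rr', Certified P ((c i).node q) r v rr') ∧
      Msg.precommit q r (some v) ∅ ∈ ((c (i + 1)).node q).log) ∨
    (vr = none ∧ Msg.precommit q r (some v) (excludedTx P ((c i).node q).log r v) ∈
      ((c (i + 1)).node q).log) ∨
    (vr ≠ none ∧ (c e).now + 2 * Δ ≤ (c i).now ∧ ¬ Lockable P ((c i).node q)) := by
  have hlt := G.lt
  generalize hs' : (c (i + 1)).node q = s' at h hph'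
  have hpr : ∀ {v' vr' rr'}, Proposed P ((c i).node q).log ((c i).node q).round v' vr' rr' →
      (v' = v ∧ vr' = vr ∧ rr' = rr) ∧ e < i := by
    intro v' vr' rr' h
    rw [hr] at h
    exact G.eq_of_proposed hq h
  cases h with
  | lock v' rr' _ hcert =>
    obtain ⟨vr', hprop⟩ := hcert.1
    obtain ⟨⟨rfl, -, -⟩, -⟩ := hpr hprop
    rw [hr] at hcert
    refine Or.inl ⟨⟨rr', hcert⟩, ?_⟩
    rw [← hr]
    exact Set.mem_insert _ _
  | precommitNil _ hnil =>
    rw [hr] at hnil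
    exact absurd hnil (G.not_prevotesFor_none href hq)
  | conflict u u' _ _ _ _ _ h1 h2 h3 =>
    exact absurd ((hpr h1).1.1.trans (hpr h2).1.1.symm) h3
  | rapidRemoval v' rr' _ hprop =>
    obtain ⟨⟨rfl, hvr, -⟩, -⟩ := hpr hprop
    refine Or.inr (Or.inl ⟨hvr.symm, ?_⟩)
    rw [← hr]
    exact Set.mem_insert _ _
  | timeoutPrevote d v' rr' _ _ _ _ hprop =>
    obtain ⟨⟨rfl, hvr, -⟩, -⟩ := hpr hprop
    refine Or.inr (Or.inl ⟨hvr.symm, ?_⟩)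
    rw [← hr]
    exact Set.mem_insert _ _
  | timeoutPrevoteNil d htimer hd _ hlock hno =>
    obtain ⟨i', hi', hr', hph'', -, hd'⟩ := G.timerPrevote_origin hq htimer
    rw [hr] at hr' hd'
    have h1 := G.now_le_of_phase_ne href hq hr' (by simp [hph''])
    have h2 := G.timeoutPrevote r (by omega)
    have h3 : (c e).now + 2 * Δ ≤ (c i).now := by linarith
    refine Or.inr (Or.inr ⟨?_, h3, hlock⟩)
    rintro rfl
    rw [hr] at hno
    exact hno ⟨v, rr, G.proposed_of_le hq h3, G.prevotesFor href hq h3⟩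
  | updateRef s₁ _ r v w rr hprop hex hrem hnovalid hshort hw h₁ h₂ =>
    subst h₁
    rcases h₂ with ⟨-, rfl⟩ | ⟨h₂, rfl⟩
    · simp at hph'
    · exact absurd hph' hph
  | skip | timeoutPrecommit => simp at hph'
  | _ => simp_all [NodeState.addMsg, castPrevote]

theorem exists_precommit_step (G : GoodRound P correct GST Δ c K R p r e v vr rr) :
    ∃ j, ∀ q ∈ correct, ∃ i < j, ((c i).node q).round = r ∧
      ((c i).node q).phase ≠ .precommit ∧ ((c (i + 1)).node q).phase = .precommit ∧
      Handler P q (c i).now ((c i).node q) ((c (i + 1)).node q) := by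
  obtain ⟨j, -, hall⟩ := G.exists_all_precommitted (show R < r by have := G.lt; omega)
  refine ⟨j, fun q hq => ?_⟩
  obtain ⟨hr, hph⟩ := hall q hq
  obtain ⟨i, hi, h1, h2, h3, h4⟩ := G.exists_enter_precommit hq hph
  exact ⟨i, hi, h1.trans hr, h2, h3, h4⟩

/-- If the proposer knows a quorum-certified value, then all correct nodes lock and precommit it,
and so it is decided. -/
theorem validRound_eq_none (G : GoodRound P correct GST Δ c K R p r e v vr rr) : vr = none := by
  by_contra hvr
  have href : vr = none → rr = none → ∀ k, K ≤ k → ∀ q ∈ correct,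
    ((c k).node q).refRound = none := fun h => absurd h hvr
  have hΔ := G.delta_pos
  obtain ⟨y, hrr, hend⟩ : ∃ y, rr = some y ∧
      VerifyEndorsement P ((c e).node p).log y v := by
    rcases G.justified with ⟨h, -⟩ | ⟨x, y, -, h, -, hend⟩
    · exact absurd h hvr
    · exact ⟨y, h, hend⟩
  obtain ⟨j, hj⟩ := G.exists_precommit_step
  have hvote : ∀ q ∈ correct, Msg.precommit q r (some v) ∅ ∈ ((c j).node q).log := by
    intro q hq
    obtain ⟨i, hi, hr, hph, hph', h⟩ := hj q hq
    rcases G.enter_precommit href hq hr hph h hph' with ⟨-, h⟩ | ⟨h, -⟩ | ⟨-, hnow, hlock⟩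
    · exact G.log_mono q (Nat.succ_le_of_lt hi) h
    · exact absurd h hvr
    · refine absurd ⟨v, rr, ?_⟩ hlock
      rw [hr]
      refine ⟨⟨vr, G.proposed_of_le hq hnow⟩, G.prevotesFor href hq hnow, G.valid,
        Or.inl ⟨y, hrr, hend.mono ?_⟩⟩
      obtain ⟨j', -, hj'⟩ := G.exists_cut (k := e) (X := (c e).now + 2 * Δ) (by linarith)
      exact (G.log_subset hj' G.mem hq G.le_index (by linarith)).trans
        (G.log_mono q (G.cut_lt hj' hnow).le)
  have hev : ∀ᶠ k in Filter.atTop, ∀ q ∈ correct,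
      Msg.precommit q r (some v) ∅ ∈ ((c k).node p).log :=
    (Filter.eventually_all_finite (Set.toFinite correct)).2 fun q hq =>
      (G.eventually_log_subset hq G.mem j).mono fun k hk => hk (hvote q hq)
  obtain ⟨K₁, hK₁⟩ := Filter.eventually_atTop.1 hev
  obtain ⟨Y, k, -, hk, hcut⟩ := G.exists_late_cut (max (e + 1) K₁) 0
  have hek : e + 1 ≤ k := (le_max_left _ _).trans hk
  exact G.not_handler hcut G.mem
    (G.started k ((G.le_index.trans (Nat.le_succ e)).trans hek) p G.mem) le_rfl hcut.lt
    ⟨_, .commit _ r v vr rr (G.log_mono p hek G.proposed)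
      (AtLeast.of_forall_mem G.quorum_le (hK₁ k ((le_max_right _ _).trans hk))) G.valid⟩

/-- If no value ever becomes certified, then some transaction of the proposed value is never
endorsed, all correct nodes suggest to remove it, and the proposer finds a new reference. -/
theorem exists_certified (G : GoodRound P correct GST Δ c K R p r e v none rr)
    (href : rr = none → ∀ k, K ≤ k → ∀ q ∈ correct, ((c k).node q).refRound = none)
    (hnever : ∀ k, ((c k).node p).validRound = none) :
    ∃ k, ∃ q ∈ correct, ∃ r v rr, Certified P ((c k).node q) r v rr := by
  by_contra! hno
  have href' : (none : Option ℕ) = none → rr = none → ∀ k, K ≤ k → ∀ q ∈ correct,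
    ((c k).node q).refRound = none := fun _ => href
  obtain ⟨tx, htx, hend⟩ : ∃ tx ∈ v, ∀ k, ∀ q ∈ correct,
      ¬ TxEndorsed P ((c k).node q).log r v tx := by
    by_contra! hall
    have h1 : ∀ᶠ k in Filter.atTop, ∀ tx ∈ {tx | tx ∈ v},
        TxEndorsed P ((c k).node p).log r v tx := by
      refine (Filter.eventually_all_finite (List.finite_toSet v)).2 fun tx htx => ?_
      obtain ⟨k, q, hq, h⟩ := hall tx htx
      exact (G.eventually_log_subset hq G.mem k).mono fun j hj => h.mono hj
    obtain ⟨k, h2, h3⟩ := (h1.and (G.exec.time.eventually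
      (Filter.eventually_ge_atTop ((c e).now + 2 * Δ)))).exists
    exact hno k p G.mem r v rr ⟨⟨none, G.proposed_of_le G.mem h3⟩,
      G.prevotesFor href' G.mem h3, G.valid, Or.inr h2⟩
  obtain ⟨j, hj⟩ := G.exists_precommit_step
  have hvote : ∀ q ∈ correct, ∃ X, Msg.precommit q r (some v) X ∈ ((c j).node q).log ∧
      tx ∈ X := by
    intro q hq
    obtain ⟨i, hi, hr, hph, hph', h⟩ := hj q hq
    rcases G.enter_precommit href' hq hr hph h hph' with ⟨⟨rr', h⟩, -⟩ | ⟨-, h⟩ | ⟨h, -⟩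
    · exact absurd h (hno i q hq r v rr')
    · exact ⟨_, G.log_mono q (Nat.succ_le_of_lt hi) h, htx, hend i q hq⟩
    · exact absurd rfl h
  have hev : ∀ᶠ k in Filter.atTop, ∀ q ∈ correct,
      ∃ X, Msg.precommit q r (some v) X ∈ ((c k).node p).log ∧ tx ∈ X :=
    (Filter.eventually_all_finite (Set.toFinite correct)).2 fun q hq =>
      (G.eventually_log_subset hq G.mem j).mono fun k hk =>
        (hvote q hq).imp fun X hX => ⟨hk hX.1, hX.2⟩
  obtain ⟨K₁, hK₁⟩ := Filter.eventually_atTop.1 hev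
  obtain ⟨Y, k, -, hk, hcut⟩ := G.exists_late_cut (max (e + 1) K₁) 0
  have hek : e + 1 ≤ k := (le_max_left _ _).trans hk
  have hKk : K ≤ k := (G.le_index.trans (Nat.le_succ e)).trans hek
  have hvotes := hK₁ k ((le_max_right _ _).trans hk)
  refine G.not_handler hcut G.mem (G.started k hKk p G.mem) le_rfl hcut.lt
    (exists_handler_of_removable p _ G.valid_nil (G.log_mono p hek G.proposed)
      (AtLeast.of_forall_mem G.quorum_le fun q hq => (hvotes q hq).imp fun X hX => hX.1)
      ⟨tx, htx, AtLeast.of_forall_mem G.succ_le hvotes⟩ (hnever k) fun u hu => ?_)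
  refine G.short rfl u ?_
  rw [G.refValue e G.le_index p G.mem, ← hu, G.refValue k hKk p G.mem]

end GoodRound

/-! ### Termination -/

theorem Undecided.exists_validRound (U : Undecided P correct GST Δ c) (hp : p ∈ correct)
    {rr : Option ℕ} (hcert : Certified P ((c k).node q) r v rr) (hq : q ∈ correct) :
    ∃ k, ((c k).node p).validRound ≠ none := by
  by_contra! hno
  obtain ⟨K, hK⟩ := Filter.eventually_atTop.1
    (U.eventually_started.and (U.eventually_log_subset hq hp k))
  obtain ⟨Y, j, -, hj, hcut⟩ := U.exists_late_cut K 0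
  obtain ⟨hs, hL⟩ := hK j hj
  exact U.not_handler hcut hp (hs p hp) le_rfl hcut.lt
    (exists_handler_of_certified p _ (hcert.mono hL) fun r' hr' => by simp [hno j] at hr')

/-- Without certified values, all correct nodes end up with references if one of them does. -/
theorem Synchronous.refRound_eq_none (S : Synchronous P correct GST Δ c K R)
    (hnever : ∀ k, ∀ q ∈ correct, ((c k).node q).validRound = none) (hp : p ∈ correct)
    (hi : K ≤ i) (hpi : ((c i).node p).refRound = none) (hq : q ∈ correct) :
    ((c k).node q).refRound = none := by
  obtain ⟨-, ⟨h, -⟩ | ⟨r, u, rr, h1, h2, hprop, hex, tx, htx, hrem⟩⟩ :=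
    (S.inv hq k).sound.of_none (hnever k q hq)
  · exact h
  · exfalso
    have hpnone : ((c i).node p).refValue = none := by
      obtain ⟨-, ⟨-, h⟩ | ⟨r, u, rr, h, -⟩⟩ := (S.inv hp i).sound.of_none (hnever i p hp)
      · exact h
      · simp [hpi] at h
    obtain ⟨K₁, hK₁⟩ := Filter.eventually_atTop.1 (S.eventually_log_subset hq hp k)
    obtain ⟨Y, j, -, hj, hcut⟩ := S.exists_late_cut (max K K₁) 0
    have hKj : K ≤ j := (le_max_left _ _).trans hj
    have hL := hK₁ j ((le_max_right _ _).trans hj)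
    refine S.not_handler hcut hp (S.started j hKj p hp) le_rfl hcut.lt
      (exists_handler_of_removable p _ S.valid_nil (hL hprop) (hex.mono hL)
        ⟨tx, htx, hrem.mono hL⟩ (hnever j p hp) fun w hw => ?_)
    rw [S.refValue j hKj p hp, ← S.refValue i hi p hp, hpnone] at hw
    simp at hw

theorem not_undecided : ¬ Undecided P correct GST Δ c := by
  intro U
  obtain ⟨p, hp, -⟩ := U.entry_spec 0
  -- whether `p` ever has a valid value
  by_cases hval : ∃ k, ((c k).node p).validRound ≠ none
  · obtain ⟨K₀, hK₀⟩ := hval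
    obtain ⟨x, hx⟩ := Option.ne_none_iff_exists'.1 hK₀
    obtain ⟨K, R, hK, S⟩ := U.exists_synchronous K₀
    obtain ⟨r, e, v, vr, rr, G⟩ := S.exists_goodRound hp
    obtain ⟨y, -, hy⟩ := U.validRound_mono p (hK.trans G.le_index) hx
    have := G.validRound
    rw [hy, G.validRound_eq_none] at this
    simp at this
  · push Not at hval
    have hnever : ∀ k, ∀ q ∈ correct, ((c k).node q).validRound = none := by
      intro k q hq
      by_contra hne
      obtain ⟨x, hx⟩ := Option.ne_none_iff_exists'.1 hne
      obtain ⟨u, rr, y, -, -, hcert, -⟩ := (U.inv hq k).sound.of_some x hx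
      obtain ⟨k', hk'⟩ := U.exists_validRound hp hcert hq
      exact hk' (hval k')
    obtain ⟨K, R, -, S⟩ := U.exists_synchronous 0
    obtain ⟨r, e, v, vr, rr, G⟩ := S.exists_goodRound hp
    obtain rfl := G.validRound_eq_none
    obtain ⟨k, q, hq, r', v', rr', hcert⟩ := G.exists_certified
      (fun h k _ q hq => S.refRound_eq_none hnever hp G.le_index (G.refRound.trans h) hq) hval
    obtain ⟨k', hk'⟩ := U.exists_validRound hp hcert hq
    exact hk' (hval k')

end GoodRounds

end FlexTender

theorem mainTheorem2 {Node Tx : Type*} [Fintype Node] (P : FlexTender.Params Node Tx)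
    (correct : Set Node) (GST Δ : ℝ) (c : ℕ → FlexTender.Config Node Tx)
    (hn : 3 * P.f + 1 ≤ Fintype.card Node)
    (hbyz : correctᶜ.ncard ≤ P.f)
    (hproposer : ∀ p R, ∃ r, R ≤ r ∧ P.proposer r = p)
    (hvalid_nil : P.valid [])
    (hvalid_sublist : ∀ u v : List Tx, u.Sublist v → P.valid v → P.valid u)
    (hΔ : 0 < Δ)
    (htimeout : ∃ R, ∀ r, R ≤ r → 2 * Δ ≤ P.timeoutPropose r ∧ 2 * Δ ≤ P.timeoutPrevote r ∧
      2 * Δ ≤ P.timeoutPrecommit r)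
    (hexec : FlexTender.IsExecution P correct GST Δ c) :
    ∀ p ∈ correct, ∃ v, ∀ᶠ k in Filter.atTop, ((c k).node p).decision = some v := by
  have H : FlexTender.Setting P correct GST Δ c :=
    ⟨hn, hbyz, hproposer, hvalid_nil, hvalid_sublist, hΔ, htimeout, hexec⟩
  intro p hp
  obtain ⟨k, q, hq, hdec⟩ : ∃ k, ∃ q ∈ correct, ((c k).node q).decision ≠ none := by
    by_contra! hno
    exact FlexTender.not_undecided ⟨H, hno⟩
  obtain ⟨u, hu⟩ := Option.ne_none_iff_exists'.1 hdec
  obtain ⟨j, v, hv⟩ := H.exists_decision hq hp hu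
  exact ⟨v, Filter.eventually_atTop.2 ⟨j, fun i hi => H.decision_mono p hi hv⟩⟩
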